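/- Let $d\ge 2$ be an integer. Consider the rectified cubic lattice whose vertices are the points of $\mathbb{Z}^3$ with exactly one odd coordinate. Its cells are the octahedra with vertices $p\pm e_i$ around the points $p\in(2\mathbb{Z})^3$, coloured $g$, and the cuboctahedra with vertices $q\pm e_i\pm e_j$ ($i\neq j$) around the points $q$ with three odd coordinates, coloured $r$ if $q_1+q_2+q_3\equiv 3$ and $b$ if $q_1+q_2+q_3\equiv 1 \pmod 4$. A $c'c''$-face is a face shared by a $c'$-cell and a $c''$-cell. The distance-$d$ lattice is the part of this lattice in the box $[0,2d-2]\times[0,2d-2]\times[1,2d-1]$: its vertices are those in the box, its cells are those with centre in the box (cut to the box), and its faces are those with at least three vertices in the box (cut to the box). Its $r$-, $b$- and $g$-boundaries are the pairs of opposite sides of the box on which the first, second and third coordinate, respectively, is constant. For each $c\in\{r,g,b\}$, with $c',c''$ the other two colours, the code $\mathcal{SC}_c$ has one qubit on every vertex of the distance-$d$ lattice and the following stabilizers: an $X$ stabilizer on every $c$-cell and a $Z$ stabilizer on every $c'c''$-face. In addition, for $\{c,\bar c\}=\{r,b\}$, $\mathcal{SC}_c$ has an $X$ stabilizer on every face of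 a $\bar c$-cell that lies on a $\bar c$-boundary, and a $Z$ stabilizer on every edge of a face of a $c$-cell lying on a $c$-boundary which, in the infinite lattice, belongs to a $\bar cg$-face. The canonical $\overline{X}_c$ operators act by $X$ on all qubits of one $c$-boundary. The canonical $\overline{Z}_c$ operators act by $Z$ on all qubits lying both on one $c'$-boundary and on one $c''$-boundary. Then: 1. Each of the three codes has $n=3d^3-4d^2+2d$ physical qubits. 2. The $X$ stabilizers of $\mathcal{SC}_g$ are independent, and the groups generated by its $X$ and by its $Z$ stabilizers have exactly $|S_X^{(g)}|=d^2(d-1)$ and $|S_Z^{(g)}|=(d-1)(2d^2-d+1)$ independent generators, respectively. For $c\in\{r,b\}$, the $X$ stabilizers of $\mathcal{SC}_c$ are independent, and the corresponding numbers are $|S_X^{(c)}|=\frac{d-1}{2}(d^2+d)$ and $|S_Z^{(c)}|=\frac{d-1}{2}(5d^2-3d+2)$. 3. For each $c$, the group generated by all the stabilizers of $\mathcal{SC}_c$ is abelian, does not contain $-I$, and has exactly $3d^3-4d^2+2d-1=n-1$ independent generators: its stabilizers contain an independent generating set of this size, and all independent generating sets have this size. 4. Each code encodes exactly one logical qubit: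 the space of states fixed by all the stabilizers of $\mathcal{SC}_c$ has dimension $2$. 5. Every canonical $\overline{Z}_c$ operator has weight $d$. Every canonical $\overline{X}_g$ operator has weight $d^2$, and every canonical $\overline{X}_r$ or $\overline{X}_b$ operator has weight $d^2+(d-1)^2$. For each $c$, the canonical $\overline{X}_c$ and $\overline{Z}_c$ operators commute with all the stabilizers of $\mathcal{SC}_c$ and anticommute with each other. -/

import Mathlib

namespace Stack3D

/-! ## Pauli operators and stabilizer codes on finitely many qubits -/

section Pauli

/-- The state space `(ℂ²)^{⊗ V}` of qubits labelled by `V`: the amplitudes `ψ b` of the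
computational basis states `|b⟩`, where `b` is a bit string. -/
abbrev StateSpace (V : Type) : Type := (V → ZMod 2) → ℂ

/-- The group of invertible operators on the state space. -/
abbrev Op (V : Type) : Type := StateSpace V ≃ₗ[ℂ] StateSpace V

variable {V : Type} [DecidableEq V]

/-- The bit string which is `1` exactly on `s`. -/
def bits (s : Finset V) : V → ZMod 2 := fun v => if v ∈ s then 1 else 0

/-- The Pauli operator `⨂_{v ∈ s} X(v)`. It maps `|b⟩` to `|b + bits s⟩`. -/
def xOp (s : Finset V) : Op V :=
  LinearEquiv.funCongrLeft ℂ ℂ (Equiv.addRight (bits s))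

/-- The Pauli operator `⨂_{v ∈ s} Z(v)`. It maps `|b⟩` to `∏_{v ∈ s} (-1)^{b v} |b⟩`. -/
def zOp (s : Finset V) : Op V :=
  LinearEquiv.ofInvolutive
    { toFun := fun ψ b => (∏ v ∈ s, (-1 : ℂ) ^ (b v).val) * ψ b
      map_add' := fun ψ φ => by
        funext b
        simp [mul_add]
      map_smul' := fun a ψ => by
        funext b
        simp [mul_left_comm] }
    (fun ψ => by
      funext b
      simp [← mul_assoc, ← Finset.prod_mul_distrib, ← mul_pow])

end Pauli

/-- The operator `-I`. -/
def negId (V : Type) : Op V := LinearEquiv.neg ℂ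

/-- An abelian group of operators which does not contain `-I`. -/
def IsStabilizerGroup {V : Type} (S : Subgroup (Op V)) : Prop :=
  (∀ g ∈ S, ∀ h ∈ S, g * h = h * g) ∧ negId V ∉ S

/-- The code space: all states fixed by every element of `S`. -/
def codeSpace {V : Type} (S : Subgroup (Op V)) : Submodule ℂ (StateSpace V) where
  carrier := {ψ | ∀ g ∈ S, g ψ = ψ}
  add_mem' := fun {ψ φ} hψ hφ g hg => by rw [map_add, hψ g hg, hφ g hg]
  zero_mem' := fun g _ => map_zero g
  smul_mem' := fun a ψ hψ g hg => by rw [map_smul, hψ g hg]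

/-- The code space of `S` is the state space of `k` logical qubits. -/
def EncodesLogicalQubits {V : Type} (S : Subgroup (Op V)) (k : ℕ) : Prop :=
  Module.finrank ℂ (codeSpace S) = 2 ^ k

/-- No element of `T` is generated by the other elements of `T`. -/
def IsIndependent {G : Type} [Group G] (T : Set G) : Prop :=
  ∀ g ∈ T, g ∉ Subgroup.closure (T \ {g})

/-- The group generated by `S` has exactly `m` independent generators: some independent subset
of `S` with `m` elements generates the group, and every independent generating set of the group
has `m` elements. (`m` is rational so that formulas can be written without truncation.) -/
def HasIndependentGenerators {G : Type} [Group G] (S : Set G) (m : ℚ) : Prop :=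
  (∃ T : Set G, T ⊆ S ∧ IsIndependent T ∧ Subgroup.closure T = Subgroup.closure S ∧
    T.Finite ∧ (T.ncard : ℚ) = m) ∧
  ∀ T : Set G, IsIndependent T → Subgroup.closure T = Subgroup.closure S →
    T.Finite ∧ (T.ncard : ℚ) = m

/-! ## The infinite rectified cubic lattice

It is the rectification of the cubic lattice `(2ℤ)³`: the vertices are the midpoints of its edges,
there is an octahedron around every one of its vertices and a cuboctahedron inside every one of its
cubes. -/

/-- The three colours. -/
inductive Colour where
  | red
  | green
  | blue
  deriving DecidableEq

/-- Points with integer coordinates `(x, y, z)`. -/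
abbrev Point : Type := ℤ × ℤ × ℤ

/-- The vertices of the infinite lattice: exactly one coordinate is odd. -/
def IsVertex (v : Point) : Prop :=
  (Odd v.1 ∧ Even v.2.1 ∧ Even v.2.2) ∨ (Even v.1 ∧ Odd v.2.1 ∧ Even v.2.2) ∨
    (Even v.1 ∧ Even v.2.1 ∧ Odd v.2.2)

instance : DecidablePred IsVertex := fun v => by
  unfold IsVertex
  infer_instance

/-- `p` is the centre of a cell of colour `c` of the infinite lattice. The green cells are the
octahedra; cuboctahedra which share a (square) face have opposite colours red and blue. -/
def IsCentre : Colour → Point → Prop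
  | .green, p => Even p.1 ∧ Even p.2.1 ∧ Even p.2.2
  | .red, p => Odd p.1 ∧ Odd p.2.1 ∧ Odd p.2.2 ∧ (p.1 + p.2.1 + p.2.2) % 4 = 3
  | .blue, p => Odd p.1 ∧ Odd p.2.1 ∧ Odd p.2.2 ∧ (p.1 + p.2.1 + p.2.2) % 4 = 1

/-- The vertices of the octahedron around `p`: the six points `p ± eᵢ`. -/
def octahedron (p : Point) : Set Point :=
  {v | |v.1 - p.1| + |v.2.1 - p.2.1| + |v.2.2 - p.2.2| = 1}

/-- The vertices of the cuboctahedron around `p`: the twelve points `p ± eᵢ ± eⱼ`, `i ≠ j`. -/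
def cuboctahedron (p : Point) : Set Point :=
  {v | |v.1 - p.1| ≤ 1 ∧ |v.2.1 - p.2.1| ≤ 1 ∧ |v.2.2 - p.2.2| ≤ 1 ∧
    |v.1 - p.1| + |v.2.1 - p.2.1| + |v.2.2 - p.2.2| = 2}

/-- The vertices of the cell of colour `c` with centre `p`. -/
def cell : Colour → Point → Set Point
  | .green, p => octahedron p
  | .red, p => cuboctahedron p
  | .blue, p => cuboctahedron p

/-! ## The finite lattice with parameter `d`

The infinite lattice is cut off at the faces of the box `[0, 2d-2] × [0, 2d-2] × [1, 2d-1]`.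
The `d` layers with odd `z` are the chequerboard layers, the `d - 1` layers with even `z` are the
diamond layers. The boundaries `z = 1` and `z = 2d-1` slice a layer of cuboctahedra in half, the
other four slice between layers of cuboctahedra. -/

/-- The corners of the box. -/
def lowCorner : Point := (0, 0, 1)

/-- See `lowCorner`. -/
def highCorner (d : ℕ) : Point := (2 * d - 2, 2 * d - 2, 2 * d - 1)

/-- The vertices of the finite lattice. -/
noncomputable def latticeVertices (d : ℕ) : Finset Point :=
  (Finset.Icc lowCorner (highCorner d)).filter IsVertex

/-- The qubits of each one of the three codes: one on every vertex. -/
abbrev Qubit (d : ℕ) : Type := ↥(latticeVertices d)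

open Classical in
/-- The qubits on a set of points. -/
noncomputable def qubitsOn (d : ℕ) (s : Set Point) : Finset (Qubit d) :=
  Finset.univ.filter fun v => v.1 ∈ s

/-- The (full or cut) cells of colour `c` of the finite lattice, as sets of qubits:
the cells whose centre lies in the box. -/
def cells (d : ℕ) (c : Colour) : Set (Finset (Qubit d)) :=
  {s | ∃ p : Point, IsCentre c p ∧ p ∈ Set.Icc lowCorner (highCorner d) ∧
    s = qubitsOn d (cell c p)}

/-- `f` is a face, shared by a cell of colour `c₁` and a cell of colour `c₂`, of the infinite
lattice. (Cells of different colours which have a vertex in common share a triangle or a square.) -/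
def IsFace (c₁ c₂ : Colour) (f : Set Point) : Prop :=
  ∃ p q : Point, IsCentre c₁ p ∧ IsCentre c₂ q ∧ f = cell c₁ p ∩ cell c₂ q ∧ f.Nonempty

/-- The (full or cut) `c₁c₂`-faces of the finite lattice, as sets of qubits: the faces
of the infinite lattice of which at least three vertices remain. The cells on both sides of a face
on the boundary give it its colours, even if one of them lies outside of the finite lattice. -/
def faces (d : ℕ) (c₁ c₂ : Colour) : Set (Finset (Qubit d)) :=
  {s | ∃ f : Set Point, IsFace c₁ c₂ f ∧ s = qubitsOn d f ∧ 3 ≤ s.card}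

/-- The coordinate which is constant on the boundaries of colour `c`. -/
def coord : Colour → Point → ℤ
  | .red, p => p.1
  | .blue, p => p.2.1
  | .green, p => p.2.2

/-- The two boundaries of colour `c`, as sets of qubits: on the low and on the high side. -/
noncomputable def boundary (d : ℕ) (c : Colour) (high : Bool) : Finset (Qubit d) :=
  qubitsOn d {p | coord c p = coord c (if high then highCorner d else lowCorner)}

/-- The faces of cells of colour `c` which lie on a boundary of colour `c`, as sets of qubits.
(Used for red and blue only.) -/
def boundaryFaces (d : ℕ) (c : Colour) : Set (Finset (Qubit d)) :=
  {s | ∃ t ∈ cells d c, ∃ high : Bool, s = t ∩ boundary d c high ∧ 3 ≤ s.card}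

/-- The edges, as sets of two qubits, of `boundaryFaces d c` which are edges of a `c₁c₂`-face of the
infinite lattice. (Used only if `c₁c₂`-faces are triangles, so any two vertices of such a face are
joined by an edge.) -/
def boundaryEdges (d : ℕ) (c c₁ c₂ : Colour) : Set (Finset (Qubit d)) :=
  {s | ∃ t ∈ boundaryFaces d c, ∃ u ∈ t, ∃ v ∈ t, u ≠ v ∧ s = {u, v} ∧
    ∃ f, IsFace c₁ c₂ f ∧ u.1 ∈ f ∧ v.1 ∈ f}

/-! ## The three codes -/

/-- The supports of the `X` stabilizers of the code of colour `c`: the `c`-cells, and for the red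
(blue) code also the faces of blue (red) cells on the blue (red) boundaries. -/
def xSupports (d : ℕ) : Colour → Set (Finset (Qubit d))
  | .green => cells d .green
  | .red => cells d .red ∪ boundaryFaces d .blue
  | .blue => cells d .blue ∪ boundaryFaces d .red

/-- The supports of the `Z` stabilizers of the code of colour `c`: the `c'c''`-faces, where `c'`
and `c''` are the other two colours, and for the red (blue) code also the edges of the faces of red
(blue) cells on the red (blue) boundaries which belong to a blue-green (red-green) face of the
infinite lattice. -/
def zSupports (d : ℕ) : Colour → Set (Finset (Qubit d))
  | .green => faces d .red .blue
  | .red => faces d .blue .green ∪ boundaryEdges d .red .blue .green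
  | .blue => faces d .red .green ∪ boundaryEdges d .blue .red .green

/-- The `X` stabilizers associated with cells and boundary faces. -/
def xStabilizers (d : ℕ) (c : Colour) : Set (Op (Qubit d)) := xOp '' xSupports d c

/-- The `Z` stabilizers associated with faces and boundary edges. -/
def zStabilizers (d : ℕ) (c : Colour) : Set (Op (Qubit d)) := zOp '' zSupports d c

/-- The stabilizer group of the code of colour `c`. -/
def stabilizerGroup (d : ℕ) (c : Colour) : Subgroup (Op (Qubit d)) :=
  Subgroup.closure (xStabilizers d c ∪ zStabilizers d c)

/-- The support of a canonical `X̄` operator of the code of colour `c`: one of the `c`-boundaries. -/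
noncomputable def canonicalX (d : ℕ) (c : Colour) (high : Bool) : Finset (Qubit d) :=
  boundary d c high

/-- The support of a canonical `Z̄` operator of the code of the third colour: the line where a
`c₁`-boundary meets a `c₂`-boundary. -/
noncomputable def canonicalZ (d : ℕ) (c₁ c₂ : Colour) (high₁ high₂ : Bool) : Finset (Qubit d) :=
  boundary d c₁ high₁ ∩ boundary d c₂ high₂

/-- `x̄` and `z̄` act on the code space of `S` as the logical `X` and `Z` of one logical qubit:
they commute with the stabilizers and anticommute with each other. -/
def IsLogicalPair {V : Type} (S : Subgroup (Op V)) (x z : Op V) : Prop :=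
  (∀ g ∈ S, x * g = g * x) ∧ (∀ g ∈ S, z * g = g * z) ∧ x * z = negId V * (z * x)

end Stack3D

open Stack3D

namespace Stack3D

/-! ## Elementary abelian `2`-groups as vector spaces over `ZMod 2` -/

section ElementaryAbelian

variable {E G : Type} [AddCommGroup E] [Module (ZMod 2) E] [Group G]

theorem mem_closure_image_iff (Φ : E → G) (hΦ : ∀ x y, Φ (x + y) = Φ x * Φ y)
    (B : Set E) (g : G) :
    g ∈ Subgroup.closure (Φ '' B) ↔ ∃ x ∈ Submodule.span (ZMod 2) B, Φ x = g := by
  have h0 : Φ 0 = 1 := by simpa using hΦ 0 0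
  have hneg : ∀ x, Φ (-x) = (Φ x)⁻¹ := fun x => by
    rw [eq_inv_iff_mul_eq_one, ← hΦ, neg_add_cancel, h0]
  constructor
  · intro hg
    induction hg using Subgroup.closure_induction with
    | mem g hg =>
      obtain ⟨x, hx, rfl⟩ := hg
      exact ⟨x, Submodule.subset_span hx, rfl⟩
    | one => exact ⟨0, Submodule.zero_mem _, h0⟩
    | mul g h _ _ ihg ihh =>
      obtain ⟨x, hx, rfl⟩ := ihg
      obtain ⟨y, hy, rfl⟩ := ihh
      exact ⟨x + y, Submodule.add_mem _ hx hy, hΦ x y⟩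
    | inv g _ ih =>
      obtain ⟨x, hx, rfl⟩ := ih
      exact ⟨-x, Submodule.neg_mem _ hx, hneg x⟩
  · rintro ⟨x, hx, rfl⟩
    induction hx using Submodule.span_induction with
    | mem x hx => exact Subgroup.subset_closure ⟨x, hx, rfl⟩
    | zero => rw [h0]; exact Subgroup.one_mem _
    | add x y _ _ ihx ihy => rw [hΦ]; exact Subgroup.mul_mem _ ihx ihy
    | smul a x _ ih =>
      fin_cases a
      · simp only [Fin.zero_eta, Fin.isValue]
        erw [zero_smul, h0]
        exact Subgroup.one_mem _
      · simp only [Fin.mk_one, Fin.isValue]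
        erw [one_smul]
        exact ih

theorem isIndependent_image_iff (Φ : E → G) (hΦ : ∀ x y, Φ (x + y) = Φ x * Φ y)
    (hinj : Function.Injective Φ) (B : Set E) :
    IsIndependent (Φ '' B) ↔ LinearIndepOn (ZMod 2) id B := by
  rw [linearIndepOn_iff_notMem_span, IsIndependent, Set.forall_mem_image]
  refine forall₂_congr fun x _ => not_congr ?_
  rw [← Set.image_singleton, ← Set.image_sdiff hinj, mem_closure_image_iff Φ hΦ, Set.image_id]
  exact ⟨fun ⟨y, hy, h⟩ => hinj h ▸ hy, fun h => ⟨x, h, rfl⟩⟩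

theorem hasIndependentGenerators_image [Module.Finite (ZMod 2) E] (Φ : E → G)
    (hΦ : ∀ x y, Φ (x + y) = Φ x * Φ y) (hinj : Function.Injective Φ) (A : Set E) :
    HasIndependentGenerators (Φ '' A)
      (Module.finrank (ZMod 2) (Submodule.span (ZMod 2) A) : ℚ) := by
  have key : ∀ B : Set E, IsIndependent (Φ '' B) →
      Subgroup.closure (Φ '' B) = Subgroup.closure (Φ '' A) →
      (Φ '' B).Finite ∧
        ((Φ '' B).ncard : ℚ) = Module.finrank (ZMod 2) (Submodule.span (ZMod 2) A) := by
    intro B hB hBA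
    rw [isIndependent_image_iff Φ hΦ hinj] at hB
    have hfin : B.Finite := LinearIndependent.setFinite hB
    have hspan : Submodule.span (ZMod 2) B = Submodule.span (ZMod 2) A := by
      ext x
      have h : ∀ C : Set E,
          Φ x ∈ Subgroup.closure (Φ '' C) ↔ x ∈ Submodule.span (ZMod 2) C := fun C => by
        rw [mem_closure_image_iff Φ hΦ]
        exact ⟨fun ⟨y, hy, h⟩ => hinj h ▸ hy, fun h => ⟨x, h, rfl⟩⟩
      rw [← h, ← h, hBA]
    have := hfin.fintype
    refine ⟨hfin.image _, ?_⟩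
    rw [Set.ncard_image_of_injective _ hinj, ← hspan, finrank_span_set_eq_card hB,
      Set.ncard_eq_toFinset_card']
  refine ⟨?_, fun T hT hTS => ?_⟩
  · obtain ⟨B, hBA, hspan, hB⟩ := exists_linearIndependent (ZMod 2) A
    have hI : IsIndependent (Φ '' B) := (isIndependent_image_iff Φ hΦ hinj B).2 hB
    have hcl : Subgroup.closure (Φ '' B) = Subgroup.closure (Φ '' A) := by
      ext g
      rw [mem_closure_image_iff Φ hΦ, mem_closure_image_iff Φ hΦ, hspan]
    exact ⟨Φ '' B, Set.image_mono hBA, hI, hcl, key B hI hcl⟩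
  · have hTΦ : Φ '' (Φ ⁻¹' T) = T := by
      refine Set.image_preimage_eq_of_subset fun g hg => ?_
      obtain ⟨x, -, hx⟩ := (mem_closure_image_iff Φ hΦ A g).1 (hTS ▸ Subgroup.subset_closure hg)
      exact ⟨x, hx⟩
    rw [← hTΦ] at hT hTS ⊢
    exact key _ hT hTS

end ElementaryAbelian

/-! ## Pauli operators and binary vectors -/

section Binary

/-- The character of `ZMod 2` with values `±1`. -/
def sgn (t : ZMod 2) : ℂ := (-1) ^ t.val

theorem sgn_zero : sgn 0 = 1 := by simp [sgn]

theorem sgn_one : sgn 1 = -1 := by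
  rw [sgn, show (1 : ZMod 2).val = 1 from rfl, pow_one]

theorem eq_zero_or_one_zmod_two : ∀ t : ZMod 2, t = 0 ∨ t = 1 := by decide

theorem sgn_add (s t : ZMod 2) : sgn (s + t) = sgn s * sgn t := by
  rcases eq_zero_or_one_zmod_two s with rfl | rfl <;>
    rcases eq_zero_or_one_zmod_two t with rfl | rfl <;>
      simp [sgn_zero, sgn_one, CharTwo.add_self_eq_zero]

theorem sgn_eq_one_iff (t : ZMod 2) : sgn t = 1 ↔ t = 0 := by
  rcases eq_zero_or_one_zmod_two t with rfl | rfl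
  · simp [sgn_zero]
  · rw [sgn_one]
    norm_num

theorem sgn_sum {ι : Type} (s : Finset ι) (f : ι → ZMod 2) :
    sgn (∑ i ∈ s, f i) = ∏ i ∈ s, sgn (f i) := by
  classical
  induction s using Finset.induction_on with
  | empty => simp [sgn_zero]
  | insert a s ha ih => rw [Finset.sum_insert ha, Finset.prod_insert ha, sgn_add, ih]

theorem add_self_zmod_two {V : Type} (a : V → ZMod 2) : a + a = 0 := by
  funext v
  exact CharTwo.add_self_eq_zero (a v)

variable {V : Type} [DecidableEq V]

theorem xOp_apply (s : Finset V) (ψ : StateSpace V) (u : V → ZMod 2) :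
    xOp s ψ u = ψ (u + bits s) := rfl

variable [Fintype V]

theorem bits_dotProduct (s : Finset V) (f : V → ZMod 2) : bits s ⬝ᵥ f = ∑ v ∈ s, f v := by
  simp [bits, dotProduct, Finset.sum_ite_mem]

theorem zOp_apply (s : Finset V) (ψ : StateSpace V) (u : V → ZMod 2) :
    zOp s ψ u = sgn (bits s ⬝ᵥ u) * ψ u := by
  rw [bits_dotProduct, sgn_sum]
  rfl

/-- The set of ones of a bit string. -/
def ones (a : V → ZMod 2) : Finset V := Finset.univ.filter fun v => a v = 1

theorem bits_ones (a : V → ZMod 2) : bits (ones a) = a := by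
  funext v
  have : ∀ t : ZMod 2, (if t = 1 then (1 : ZMod 2) else 0) = t := by decide
  simpa [bits, ones] using this (a v)

theorem bits_dotProduct_bits (s t : Finset V) :
    bits s ⬝ᵥ bits t = ((s ∩ t).card : ZMod 2) := by
  rw [bits_dotProduct]
  simp [bits, Finset.sum_ite_mem]

/-- The operator `X^a Z^b`. -/
def pauli (a b : V → ZMod 2) : Op V := xOp (ones a) * zOp (ones b)

theorem pauli_apply (a b : V → ZMod 2) (ψ : StateSpace V) (u : V → ZMod 2) :
    pauli a b ψ u = sgn (b ⬝ᵥ (u + a)) * ψ (u + a) := by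
  change xOp (ones a) (zOp (ones b) ψ) u = _
  rw [xOp_apply, zOp_apply, bits_ones, bits_ones]

theorem pauli_bits_zero (s : Finset V) : pauli (bits s) 0 = xOp s := by
  ext ψ u
  rw [pauli_apply, xOp_apply, zero_dotProduct, sgn_zero, one_mul]

theorem pauli_zero_bits (s : Finset V) : pauli 0 (bits s) = zOp s := by
  ext ψ u
  rw [pauli_apply, zOp_apply, add_zero]

theorem pauli_mul (a b a' b' : V → ZMod 2) (h : b ⬝ᵥ a' = 0) :
    pauli (a + a') (b + b') = pauli a b * pauli a' b' := by
  ext ψ u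
  change _ = pauli a b (pauli a' b' ψ) u
  rw [pauli_apply, pauli_apply, pauli_apply, add_dotProduct, sgn_add, ← mul_assoc,
    ← add_assoc u a a', dotProduct_add b (u + a), h, add_zero]

theorem pauli_injective {a b a' b' : V → ZMod 2} (h : pauli a b = pauli a' b') :
    a = a' ∧ b = b' := by
  have happ : ∀ (ψ : StateSpace V) u, sgn (b ⬝ᵥ (u + a)) * ψ (u + a) = sgn (b' ⬝ᵥ (u + a')) * ψ (u + a') :=
    fun ψ u => by rw [← pauli_apply, ← pauli_apply, h]
  have ha : a = a' := by
    by_contra hne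
    have := happ (Pi.single a 1) 0
    rw [zero_add, zero_add, Pi.single_eq_same, Pi.single_eq_of_ne (Ne.symm hne), mul_zero,
      mul_one] at this
    exact pow_ne_zero _ (by norm_num) this
  subst ha
  refine ⟨rfl, ?_⟩
  have hb : ∀ u, b ⬝ᵥ u = b' ⬝ᵥ u := fun u => by
    have hu := happ (fun _ => 1) (u + a)
    rw [add_assoc, add_self_zmod_two, add_zero, mul_one, mul_one] at hu
    have h2 : sgn (b ⬝ᵥ u + b' ⬝ᵥ u) = 1 := by
      rw [sgn_add, hu, ← sgn_add, CharTwo.add_self_eq_zero, sgn_zero]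
    exact CharTwo.add_eq_zero.1 ((sgn_eq_one_iff _).1 h2)
  exact dotProduct_eq _ _ hb

theorem xOp_mul_zOp (s t : Finset V) (h : Even (s ∩ t).card) :
    xOp s * zOp t = zOp t * xOp s := by
  have h0 : bits t ⬝ᵥ bits s = 0 := by
    rw [bits_dotProduct_bits, Finset.inter_comm]
    exact (ZMod.natCast_eq_zero_iff_even).2 h
  rw [← pauli_bits_zero, ← pauli_zero_bits, ← pauli_mul _ _ _ _ (by simp),
    ← pauli_mul _ _ _ _ h0, add_comm (bits s), add_comm (bits t)]

theorem xOp_mul_xOp (s t : Finset V) : xOp s * xOp t = xOp t * xOp s := by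
  rw [← pauli_bits_zero, ← pauli_bits_zero, ← pauli_mul _ _ _ _ (by simp),
    ← pauli_mul _ _ _ _ (by simp), add_comm]

theorem zOp_mul_zOp (s t : Finset V) : zOp s * zOp t = zOp t * zOp s := by
  rw [← pauli_zero_bits, ← pauli_zero_bits, ← pauli_mul _ _ _ _ (by simp),
    ← pauli_mul _ _ _ _ (by simp), add_comm (bits s)]

theorem xOp_mul_zOp_of_odd (s t : Finset V) (h : Odd (s ∩ t).card) :
    xOp s * zOp t = negId V * (zOp t * xOp s) := by
  have h1 : bits t ⬝ᵥ bits s = 1 := by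
    rw [bits_dotProduct_bits, Finset.inter_comm]
    exact (ZMod.natCast_eq_one_iff_odd).2 h
  ext ψ u
  change xOp s (zOp t ψ) u = -(zOp t (xOp s ψ) u)
  rw [xOp_apply, zOp_apply, zOp_apply, xOp_apply, dotProduct_add, h1, sgn_add, sgn_one]
  ring

end Binary

set_option linter.unusedSectionVars false

/-! ## CSS codes with a triangular family of `X` stabilizers -/

section PivotedCode

variable {V ι : Type} [DecidableEq V] [Fintype V] [Fintype ι]

/-- The CSS code with `X` supports `A` and `Z` supports `B` encodes one logical qubit, for the
following reason. The `X` supports are listed by `X`, and each one has a pivot, such that the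
pivots of other `X` supports contained in it have larger rank. A vector orthogonal to all `Z`
supports vanishes if it vanishes at the pivots and at `v₀`. The sets `x₀` and `z₀` support an
anticommuting pair of logical operators. -/
structure IsPivotedCode (A B : Set (Finset V)) (X : ι → Finset V) (pivot : ι → V) (rank : V → ℤ)
    (x₀ z₀ : Finset V) (v₀ : V) : Prop where
  range_eq : Set.range X = A
  pivot_mem : ∀ i, pivot i ∈ X i
  rank_lt : ∀ i j, i ≠ j → pivot j ∈ X i → rank (pivot i) < rank (pivot j)
  even_inter : ∀ s ∈ A, ∀ t ∈ B, Even (s ∩ t).card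
  even_x₀ : ∀ t ∈ B, Even (x₀ ∩ t).card
  even_z₀ : ∀ s ∈ A, Even (s ∩ z₀).card
  odd_x₀_z₀ : Odd (x₀ ∩ z₀).card
  eq_zero : ∀ f : V → ZMod 2, (∀ t ∈ B, ∑ v ∈ t, f v = 0) → (∀ i, f (pivot i) = 0) → f v₀ = 0 →
    f = 0

/-- The span of a family of supports. -/
abbrev bitSpan (A : Set (Finset V)) : Submodule (ZMod 2) (V → ZMod 2) :=
  Submodule.span (ZMod 2) (bits '' A)

/-- The bit strings orthogonal to a family of supports. -/
def bitKer (B : Set (Finset V)) : Submodule (ZMod 2) (V → ZMod 2) where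
  carrier := {f | ∀ t ∈ B, bits t ⬝ᵥ f = 0}
  add_mem' := fun {f g} hf hg t ht => by rw [dotProduct_add, hf t ht, hg t ht, add_zero]
  zero_mem' := fun t _ => dotProduct_zero _
  smul_mem' := fun a f hf t ht => by rw [dotProduct_smul, hf t ht, smul_zero]

theorem mem_bitKer {B : Set (Finset V)} {f : V → ZMod 2} :
    f ∈ bitKer B ↔ ∀ t ∈ B, bits t ⬝ᵥ f = 0 := Iff.rfl

theorem dotProduct_eq_zero_of_mem {B : Set (Finset V)} {f b : V → ZMod 2} (hf : f ∈ bitKer B)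
    (hb : b ∈ bitSpan B) : b ⬝ᵥ f = 0 := by
  induction hb using Submodule.span_induction with
  | mem x hx =>
    obtain ⟨t, ht, rfl⟩ := hx
    exact hf t ht
  | zero => exact zero_dotProduct _
  | add x y _ _ ihx ihy => rw [add_dotProduct, ihx, ihy, add_zero]
  | smul a x _ ih => rw [smul_dotProduct, ih, smul_zero]

theorem finrank_bitSpan_add_finrank_bitKer (B : Set (Finset V)) :
    Module.finrank (ZMod 2) (bitSpan B) + Module.finrank (ZMod 2) (bitKer B) =
      Fintype.card V := by
  let M : Matrix B V (ZMod 2) := fun t => bits t.1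
  have hker : LinearMap.ker M.mulVecLin = bitKer B := by
    ext f
    simp only [LinearMap.mem_ker, Matrix.mulVecLin_apply, mem_bitKer, funext_iff, Subtype.forall]
    rfl
  have hrow : Submodule.span (ZMod 2) (Set.range M.row) = bitSpan B := by
    rw [bitSpan, Set.image_eq_range]
    rfl
  have h := LinearMap.finrank_range_add_finrank_ker M.mulVecLin
  rw [hker, Module.finrank_fintype_fun_eq_card] at h
  rw [← hrow, ← Matrix.rank_eq_finrank_span_row]
  exact h

theorem even_card_iff_dotProduct (s t : Finset V) :
    Even (s ∩ t).card ↔ bits t ⬝ᵥ bits s = 0 := by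
  rw [bits_dotProduct_bits, Finset.inter_comm, ZMod.natCast_eq_zero_iff_even]

theorem image_xOp (A : Set (Finset V)) :
    xOp '' A = (fun a => pauli a 0) '' (bits '' A) := by
  rw [Set.image_image]
  exact Set.image_congr fun s _ => (pauli_bits_zero s).symm

theorem image_zOp (B : Set (Finset V)) :
    zOp '' B = (fun b => pauli 0 b) '' (bits '' B) := by
  rw [Set.image_image]
  exact Set.image_congr fun s _ => (pauli_zero_bits s).symm

theorem hasIndependentGenerators_xOp (A : Set (Finset V)) :
    HasIndependentGenerators (xOp '' A) (Module.finrank (ZMod 2) (bitSpan A) : ℚ) := by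
  rw [image_xOp]
  refine hasIndependentGenerators_image _ (fun a b => ?_) (fun a b h => ?_) _
  · simpa using pauli_mul a 0 b 0 (by simp)
  · exact (pauli_injective h).1

theorem hasIndependentGenerators_zOp (B : Set (Finset V)) :
    HasIndependentGenerators (zOp '' B) (Module.finrank (ZMod 2) (bitSpan B) : ℚ) := by
  rw [image_zOp]
  refine hasIndependentGenerators_image _ (fun a b => ?_) (fun a b h => ?_) _
  · simpa using pauli_mul 0 a 0 b (by simp)
  · exact (pauli_injective h).2

theorem hasIndependentGenerators_union {A B : Set (Finset V)} (h : bitSpan A ≤ bitKer B) :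
    HasIndependentGenerators (xOp '' A ∪ zOp '' B)
      ((Module.finrank (ZMod 2) (bitSpan A) + Module.finrank (ZMod 2) (bitSpan B) : ℕ) : ℚ) := by
  let Φ : bitSpan A × bitSpan B → Op V := fun e => pauli e.1 e.2
  have hΦ : ∀ x y, Φ (x + y) = Φ x * Φ y := fun x y =>
    pauli_mul _ _ _ _ (dotProduct_eq_zero_of_mem (h y.1.2) x.2.2)
  have hinj : Function.Injective Φ := fun x y hxy =>
    Prod.ext (Subtype.ext (pauli_injective hxy).1) (Subtype.ext (pauli_injective hxy).2)
  let S : Set (Op V) := xOp '' A ∪ zOp '' B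
  have himage : Φ '' (Φ ⁻¹' S) = S := by
    refine Set.image_preimage_eq_of_subset ?_
    rintro _ (⟨s, hs, rfl⟩ | ⟨t, ht, rfl⟩)
    · exact ⟨(⟨bits s, Submodule.subset_span ⟨s, hs, rfl⟩⟩, 0), pauli_bits_zero s⟩
    · exact ⟨(0, ⟨bits t, Submodule.subset_span ⟨t, ht, rfl⟩⟩), pauli_zero_bits t⟩
  have hspan : Submodule.span (ZMod 2) (Φ ⁻¹' S) = ⊤ := by
    have hX : bitSpan A ≤ ((Submodule.span (ZMod 2) (Φ ⁻¹' S)).comap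
        (LinearMap.inl _ _ _)).map (bitSpan A).subtype := by
      refine Submodule.span_le.2 ?_
      rintro _ ⟨s, hs, rfl⟩
      refine ⟨⟨bits s, Submodule.subset_span ⟨s, hs, rfl⟩⟩, Submodule.subset_span ?_, rfl⟩
      exact Or.inl ⟨s, hs, (pauli_bits_zero s).symm⟩
    have hZ : bitSpan B ≤ ((Submodule.span (ZMod 2) (Φ ⁻¹' S)).comap
        (LinearMap.inr _ _ _)).map (bitSpan B).subtype := by
      refine Submodule.span_le.2 ?_
      rintro _ ⟨s, hs, rfl⟩
      refine ⟨⟨bits s, Submodule.subset_span ⟨s, hs, rfl⟩⟩, Submodule.subset_span ?_, rfl⟩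
      exact Or.inr ⟨s, hs, (pauli_zero_bits s).symm⟩
    refine eq_top_iff.2 fun e _ => ?_
    obtain ⟨a, ha, hae⟩ := hX e.1.2
    obtain ⟨b, hb, hbe⟩ := hZ e.2.2
    have := Submodule.add_mem _ (Submodule.mem_comap.1 ha) (Submodule.mem_comap.1 hb)
    rw [LinearMap.inl_apply, LinearMap.inr_apply, Prod.mk_add_mk, add_zero, zero_add,
      Subtype.ext hae, Subtype.ext hbe] at this
    exact this
  have := hasIndependentGenerators_image Φ hΦ hinj (Φ ⁻¹' S)
  rwa [himage, hspan, finrank_top, Module.finrank_prod] at this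

/-! ### The code space -/

theorem mem_codeSpace_closure {S : Set (Op V)} {ψ : StateSpace V} :
    ψ ∈ codeSpace (Subgroup.closure S) ↔ ∀ g ∈ S, g ψ = ψ := by
  refine ⟨fun h g hg => h g (Subgroup.subset_closure hg), fun h g hg => ?_⟩
  induction hg using Subgroup.closure_induction with
  | mem g hg => exact h g hg
  | one => rfl
  | mul g k _ _ ihg ihk =>
    change g (k ψ) = ψ
    rw [ihk, ihg]
  | inv g _ ih =>
    change g.symm ψ = ψ
    rw [LinearEquiv.symm_apply_eq, ih]

theorem mem_codeSpace_iff {A B : Set (Finset V)} {ψ : StateSpace V} :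
    ψ ∈ codeSpace (Subgroup.closure (xOp '' A ∪ zOp '' B)) ↔
      (∀ a ∈ bitSpan A, ∀ u, ψ (u + a) = ψ u) ∧ ∀ u, u ∉ bitKer B → ψ u = 0 := by
  rw [mem_codeSpace_closure]
  constructor
  · intro h
    refine ⟨fun a ha => ?_, fun u hu => ?_⟩
    · induction ha using Submodule.span_induction with
      | mem x hx =>
        obtain ⟨s, hs, rfl⟩ := hx
        intro u
        exact congrFun (h _ (Or.inl ⟨s, hs, rfl⟩)) u
      | zero => simp
      | add x y _ _ ihx ihy =>
        intro u
        rw [← add_assoc, ihy, ihx]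
      | smul c x _ ih =>
        rcases eq_zero_or_one_zmod_two c with rfl | rfl
        · simp
        · simpa using ih
    · simp only [mem_bitKer, not_forall] at hu
      obtain ⟨t, ht, hne⟩ := hu
      have h1 := congrFun (h _ (Or.inr ⟨t, ht, rfl⟩)) u
      rw [zOp_apply, (eq_zero_or_one_zmod_two _).resolve_left hne, sgn_one] at h1
      linear_combination (-1 / 2 : ℂ) * h1
  · rintro ⟨hX, hZ⟩ _ (⟨s, hs, rfl⟩ | ⟨t, ht, rfl⟩)
    · ext u
      rw [xOp_apply, hX _ (Submodule.subset_span ⟨s, hs, rfl⟩)]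
    · ext u
      rw [zOp_apply]
      by_cases hu : u ∈ bitKer B
      · rw [hu t ht, sgn_zero, one_mul]
      · rw [hZ u hu, mul_zero]

open Classical in
/-- The states of the code space are the functions on the cosets of the span of the `X` supports
in the orthogonal space of the `Z` supports. -/
noncomputable def codeSpaceEquiv {A B : Set (Finset V)} (h : bitSpan A ≤ bitKer B) :
    codeSpace (Subgroup.closure (xOp '' A ∪ zOp '' B)) ≃ₗ[ℂ]
      ((bitKer B ⧸ (bitSpan A).submoduleOf (bitKer B)) → ℂ) where
  toFun ψ q := ψ.1 q.out.1
  map_add' _ _ := rfl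
  map_smul' _ _ := rfl
  invFun φ := ⟨fun u => if hu : u ∈ bitKer B then φ (Submodule.Quotient.mk ⟨u, hu⟩) else 0, by
    rw [mem_codeSpace_iff]
    refine ⟨fun a ha u => ?_, fun u hu => dif_neg hu⟩
    by_cases hu : u ∈ bitKer B
    · rw [dif_pos hu, dif_pos (Submodule.add_mem _ hu (h ha))]
      congr 1
      rw [Submodule.Quotient.eq]
      change u + a - u ∈ bitSpan A
      rwa [add_sub_cancel_left]
    · rw [dif_neg hu, dif_neg]
      rwa [Submodule.add_mem_iff_left _ (h ha)]⟩
  left_inv ψ := by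
    obtain ⟨hX, hZ⟩ := mem_codeSpace_iff.1 ψ.2
    ext u
    by_cases hu : u ∈ bitKer B
    · simp only [dif_pos hu]
      have hq := (Submodule.Quotient.eq ((bitSpan A).submoduleOf (bitKer B))).1
        (Quotient.out_eq (Submodule.Quotient.mk
          (p := (bitSpan A).submoduleOf (bitKer B)) (⟨u, hu⟩ : bitKer B)))
      have := hX _ hq u
      simpa using this
    · simp only [dif_neg hu]
      exact (hZ u hu).symm
  right_inv φ := by
    funext q
    have hq : q.out.1 ∈ bitKer B := q.out.2
    simp only [dif_pos hq]
    exact congrArg φ (Quotient.out_eq q)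

theorem finrank_codeSpace {A B : Set (Finset V)} (h : bitSpan A ≤ bitKer B) :
    Module.finrank ℂ (codeSpace (Subgroup.closure (xOp '' A ∪ zOp '' B))) =
      2 ^ (Module.finrank (ZMod 2) (bitKer B) - Module.finrank (ZMod 2) (bitSpan A)) := by
  classical
  have := Fintype.ofFinite (bitKer B ⧸ (bitSpan A).submoduleOf (bitKer B))
  rw [(codeSpaceEquiv h).finrank_eq, Module.finrank_fintype_fun_eq_card,
    Module.card_eq_pow_finrank (K := ZMod 2), ZMod.card]
  have h1 := Submodule.finrank_quotient_add_finrank ((bitSpan A).submoduleOf (bitKer B))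
  rw [(Submodule.submoduleOfEquivOfLe h).finrank_eq] at h1
  congr 1
  omega

theorem isStabilizerGroup_closure {A B : Set (Finset V)}
    (h : ∀ s ∈ A, ∀ t ∈ B, Even (s ∩ t).card)
    (h' : Module.finrank ℂ (codeSpace (Subgroup.closure (xOp '' A ∪ zOp '' B))) ≠ 0) :
    IsStabilizerGroup (Subgroup.closure (xOp '' A ∪ zOp '' B)) := by
  constructor
  · intro g hg k hk
    have hcomm : ∀ g ∈ xOp '' A ∪ zOp '' B, ∀ k ∈ xOp '' A ∪ zOp '' B, g * k = k * g := by
      rintro _ (⟨s, hs, rfl⟩ | ⟨s, hs, rfl⟩) _ (⟨t, ht, rfl⟩ | ⟨t, ht, rfl⟩)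
      · exact xOp_mul_xOp s t
      · exact xOp_mul_zOp s t (h s hs t ht)
      · exact (xOp_mul_zOp t s (h t ht s hs)).symm
      · exact zOp_mul_zOp s t
    have := Subgroup.isMulCommutative_closure hcomm
    exact congrArg Subtype.val (mul_comm' (⟨g, hg⟩ : Subgroup.closure _) ⟨k, hk⟩)
  · intro hneg
    apply h'
    have hbot : codeSpace (Subgroup.closure (xOp '' A ∪ zOp '' B)) = ⊥ := by
      refine (Submodule.eq_bot_iff _).2 fun ψ hψ => ?_
      have h1 : -ψ = ψ := hψ _ hneg
      exact self_eq_neg.1 h1.symm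
    rw [hbot, finrank_bot]

theorem commute_closure {S : Set (Op V)} {x : Op V} (h : ∀ g ∈ S, x * g = g * x) :
    ∀ g ∈ Subgroup.closure S, x * g = g * x := by
  intro g hg
  have : Subgroup.closure S ≤ Subgroup.centralizer {x} :=
    (Subgroup.closure_le _).2 fun g hg => by
      rw [SetLike.mem_coe, Subgroup.mem_centralizer_singleton_iff]
      exact (h g hg).symm
  exact (Subgroup.mem_centralizer_singleton_iff.1 (this hg)).symm

theorem isLogicalPair_closure {A B : Set (Finset V)} {x z : Finset V}
    (hx : ∀ t ∈ B, Even (x ∩ t).card) (hz : ∀ s ∈ A, Even (s ∩ z).card)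
    (hxz : Odd (x ∩ z).card) :
    IsLogicalPair (Subgroup.closure (xOp '' A ∪ zOp '' B)) (xOp x) (zOp z) := by
  refine ⟨commute_closure ?_, commute_closure ?_, xOp_mul_zOp_of_odd x z hxz⟩
  · rintro _ (⟨s, hs, rfl⟩ | ⟨t, ht, rfl⟩)
    · exact xOp_mul_xOp x s
    · exact xOp_mul_zOp x t (hx t ht)
  · rintro _ (⟨s, hs, rfl⟩ | ⟨t, ht, rfl⟩)
    · exact (xOp_mul_zOp s z (hz s hs)).symm
    · exact zOp_mul_zOp z t

/-! ### Dimensions -/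

namespace IsPivotedCode

variable {A B : Set (Finset V)} {X : ι → Finset V} {pivot : ι → V} {rank : V → ℤ}
  {x₀ z₀ : Finset V} {v₀ : V}

theorem linearIndependent (h : IsPivotedCode A B X pivot rank x₀ z₀ v₀) :
    LinearIndependent (ZMod 2) fun i => bits (X i) := by
  classical
  rw [linearIndependent_iff']
  intro s g hg
  by_contra! hne
  obtain ⟨i, hi, hmin⟩ := (s.filter fun i => g i ≠ 0).exists_min_image (fun i => rank (pivot i))
    (let ⟨i, hi, hgi⟩ := hne; ⟨i, Finset.mem_filter.2 ⟨hi, hgi⟩⟩)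
  obtain ⟨his, hgi⟩ := Finset.mem_filter.1 hi
  have hsum := congrFun hg (pivot i)
  rw [Finset.sum_apply, Finset.sum_eq_single i] at hsum
  · exact hgi (by simpa [bits, h.pivot_mem i] using hsum)
  · intro j hj hji
    by_cases hgj : g j = 0
    · simp [hgj]
    · have hnot : pivot i ∉ X j := fun hmem =>
        absurd (h.rank_lt j i hji hmem)
          (not_lt.2 (hmin j (Finset.mem_filter.2 ⟨hj, hgj⟩)))
      simp [bits, hnot]
  · exact fun h => absurd his h

theorem finrank_bitSpan_x (h : IsPivotedCode A B X pivot rank x₀ z₀ v₀) :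
    Module.finrank (ZMod 2) (bitSpan A) = Fintype.card ι := by
  rw [← finrank_span_eq_card h.linearIndependent, ← h.range_eq, bitSpan, ← Set.range_comp]
  rfl

theorem bitSpan_le (h : IsPivotedCode A B X pivot rank x₀ z₀ v₀) : bitSpan A ≤ bitKer B := by
  refine Submodule.span_le.2 ?_
  rintro _ ⟨s, hs, rfl⟩ t ht
  exact (even_card_iff_dotProduct s t).1 (h.even_inter s hs t ht)

theorem finrank_bitKer (h : IsPivotedCode A B X pivot rank x₀ z₀ v₀) :
    Module.finrank (ZMod 2) (bitKer B) = Fintype.card ι + 1 := by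
  apply le_antisymm
  · let ρ : bitKer B →ₗ[ZMod 2] (Option ι → ZMod 2) :=
      (LinearMap.funLeft (ZMod 2) (ZMod 2) fun o : Option ι => o.elim v₀ pivot).comp
        (bitKer B).subtype
    have hρ : Function.Injective ρ := by
      rw [← LinearMap.ker_eq_bot, LinearMap.ker_eq_bot']
      intro f hf
      refine Subtype.ext (h.eq_zero f.1 (fun t ht => ?_) (fun i => congrFun hf (some i))
        (congrFun hf none))
      rw [← bits_dotProduct]
      exact f.2 t ht
    have := LinearMap.finrank_le_finrank_of_injective hρ
    rwa [Module.finrank_fintype_fun_eq_card, Fintype.card_option] at this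
  · rw [← h.finrank_bitSpan_x]
    refine Submodule.finrank_lt_finrank_of_lt (lt_of_le_of_ne h.bitSpan_le fun heq => ?_)
    have hx : bits x₀ ∈ bitSpan A := by
      rw [heq]
      exact fun t ht => (even_card_iff_dotProduct x₀ t).1 (h.even_x₀ t ht)
    have hz : bits z₀ ∈ bitKer A := fun s hs => by
      rw [← even_card_iff_dotProduct, Finset.inter_comm]
      exact h.even_z₀ s hs
    have h0 := dotProduct_eq_zero_of_mem hz hx
    rw [← even_card_iff_dotProduct, Finset.inter_comm] at h0
    exact Nat.not_even_iff_odd.2 h.odd_x₀_z₀ h0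

theorem finrank_bitSpan_z (h : IsPivotedCode A B X pivot rank x₀ z₀ v₀) :
    (Module.finrank (ZMod 2) (bitSpan B) : ℚ) = Fintype.card V - 1 - Fintype.card ι := by
  have := finrank_bitSpan_add_finrank_bitKer B
  rw [h.finrank_bitKer] at this
  rw [← this]
  push_cast
  ring

theorem isIndependent_x (h : IsPivotedCode A B X pivot rank x₀ z₀ v₀) :
    IsIndependent (xOp '' A) := by
  rw [image_xOp, isIndependent_image_iff _ (fun a b => by simpa using pauli_mul a 0 b 0 (by simp))
    (fun a b h => (pauli_injective h).1), ← h.range_eq, ← Set.range_comp]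
  exact h.linearIndependent.linearIndepOn_id

theorem hasIndependentGenerators_x (h : IsPivotedCode A B X pivot rank x₀ z₀ v₀) :
    HasIndependentGenerators (xOp '' A) (Fintype.card ι : ℚ) :=
  h.finrank_bitSpan_x ▸ hasIndependentGenerators_xOp A

theorem hasIndependentGenerators_z (h : IsPivotedCode A B X pivot rank x₀ z₀ v₀) :
    HasIndependentGenerators (zOp '' B) ((Fintype.card V : ℚ) - 1 - Fintype.card ι) :=
  h.finrank_bitSpan_z ▸ hasIndependentGenerators_zOp B

theorem hasIndependentGenerators (h : IsPivotedCode A B X pivot rank x₀ z₀ v₀) :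
    HasIndependentGenerators (xOp '' A ∪ zOp '' B) ((Fintype.card V : ℚ) - 1) := by
  have := hasIndependentGenerators_union h.bitSpan_le
  rwa [Nat.cast_add, h.finrank_bitSpan_x, h.finrank_bitSpan_z, add_sub_cancel] at this

theorem finrank_codeSpace_eq (h : IsPivotedCode A B X pivot rank x₀ z₀ v₀) :
    Module.finrank ℂ (codeSpace (Subgroup.closure (xOp '' A ∪ zOp '' B))) = 2 ^ 1 := by
  rw [finrank_codeSpace h.bitSpan_le, h.finrank_bitKer, h.finrank_bitSpan_x, Nat.add_sub_cancel_left]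

theorem isStabilizerGroup (h : IsPivotedCode A B X pivot rank x₀ z₀ v₀) :
    IsStabilizerGroup (Subgroup.closure (xOp '' A ∪ zOp '' B)) :=
  isStabilizerGroup_closure h.even_inter (by rw [h.finrank_codeSpace_eq]; norm_num)

end IsPivotedCode

end PivotedCode

/-! ## Sets of qubits given by sets of points -/

theorem isVertex_iff (v : Point) :
    IsVertex v ↔ (v.1 % 2 = 1 ∧ v.2.1 % 2 = 0 ∧ v.2.2 % 2 = 0) ∨
      (v.1 % 2 = 0 ∧ v.2.1 % 2 = 1 ∧ v.2.2 % 2 = 0) ∨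
      (v.1 % 2 = 0 ∧ v.2.1 % 2 = 0 ∧ v.2.2 % 2 = 1) := by
  simp only [IsVertex, Int.odd_iff, Int.even_iff]

theorem mem_box_iff {d : ℕ} {v : Point} :
    v ∈ Set.Icc lowCorner (highCorner d) ↔ (0 ≤ v.1 ∧ v.1 ≤ 2 * d - 2) ∧
      (0 ≤ v.2.1 ∧ v.2.1 ≤ 2 * d - 2) ∧ (1 ≤ v.2.2 ∧ v.2.2 ≤ 2 * d - 1) := by
  simp only [Set.mem_Icc, lowCorner, highCorner, Prod.le_def]
  tauto

theorem mem_latticeVertices {d : ℕ} {v : Point} :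
    v ∈ latticeVertices d ↔ ((0 ≤ v.1 ∧ v.1 ≤ 2 * d - 2) ∧
      (0 ≤ v.2.1 ∧ v.2.1 ≤ 2 * d - 2) ∧ (1 ≤ v.2.2 ∧ v.2.2 ≤ 2 * d - 1)) ∧ IsVertex v := by
  rw [latticeVertices, Finset.mem_filter, ← mem_box_iff, Finset.mem_Icc, Set.mem_Icc]

theorem mem_qubitsOn {d : ℕ} {s : Set Point} {v : Qubit d} : v ∈ qubitsOn d s ↔ v.1 ∈ s := by
  simp [qubitsOn]

theorem qubitsOn_congr {d : ℕ} {s t : Set Point}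
    (h : ∀ v ∈ latticeVertices d, v ∈ s ↔ v ∈ t) : qubitsOn d s = qubitsOn d t := by
  ext v
  rw [mem_qubitsOn, mem_qubitsOn, h v.1 v.2]

theorem qubitsOn_inter (d : ℕ) (s t : Set Point) :
    qubitsOn d s ∩ qubitsOn d t = qubitsOn d (s ∩ t) := by
  ext v
  simp [mem_qubitsOn]

theorem three_le_card_qubitsOn_iff {d : ℕ} {s : Set Point} :
    3 ≤ (qubitsOn d s).card ↔ ∃ u ∈ latticeVertices d, ∃ v ∈ latticeVertices d,
      ∃ w ∈ latticeVertices d, u ∈ s ∧ v ∈ s ∧ w ∈ s ∧ u ≠ v ∧ u ≠ w ∧ v ≠ w := by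
  rw [show 3 ≤ (qubitsOn d s).card ↔ 2 < (qubitsOn d s).card from Iff.rfl, Finset.two_lt_card]
  simp only [mem_qubitsOn, ne_eq, Subtype.ext_iff]
  constructor
  · rintro ⟨u, hu, v, hv, w, hw, h⟩
    exact ⟨u.1, u.2, v.1, v.2, w.1, w.2, hu, hv, hw, h⟩
  · rintro ⟨u, hu, v, hv, w, hw, h1, h2, h3, h⟩
    exact ⟨⟨u, hu⟩, h1, ⟨v, hv⟩, h2, ⟨w, hw⟩, h3, h⟩

open Classical in
/-- The extension by zero of a bit string to all points. -/
noncomputable def extend {d : ℕ} (f : Qubit d → ZMod 2) (v : Point) : ZMod 2 :=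
  if h : v ∈ latticeVertices d then f ⟨v, h⟩ else 0

theorem extend_of_notMem {d : ℕ} (f : Qubit d → ZMod 2) {v : Point}
    (h : v ∉ latticeVertices d) : extend f v = 0 := dif_neg h

theorem extend_coe {d : ℕ} (f : Qubit d → ZMod 2) (v : Qubit d) : extend f v.1 = f v :=
  dif_pos v.2

theorem sum_qubitsOn {d : ℕ} (f : Qubit d → ZMod 2) (t : Finset Point) :
    ∑ v ∈ qubitsOn d ↑t, f v = ∑ v ∈ t, extend f v := by
  have h : ∑ v ∈ t, extend f v = ∑ v ∈ t.filter (· ∈ latticeVertices d), extend f v := by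
    rw [Finset.sum_filter]
    refine Finset.sum_congr rfl fun v _ => ?_
    split_ifs with hv
    · rfl
    · exact extend_of_notMem f hv
  rw [h]
  refine Finset.sum_bij (fun v _ => v.1) (fun v hv => ?_) (fun u _ v _ => Subtype.ext)
    (fun v hv => ?_) (fun v _ => (extend_coe f v).symm)
  · exact Finset.mem_filter.2 ⟨mem_qubitsOn.1 hv, v.2⟩
  · obtain ⟨hv1, hv2⟩ := Finset.mem_filter.1 hv
    exact ⟨⟨v, hv2⟩, mem_qubitsOn.2 hv1, rfl⟩

open Classical in
/-- The indicator function of the qubits on a set of points. -/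
noncomputable def indicator (d : ℕ) (s : Set Point) (v : Point) : ZMod 2 :=
  if v ∈ latticeVertices d ∧ v ∈ s then 1 else 0

theorem extend_bits_qubitsOn (d : ℕ) (s : Set Point) :
    extend (bits (qubitsOn d s)) = indicator d s := by
  classical
  funext v
  by_cases h : v ∈ latticeVertices d <;> simp [extend, indicator, bits, mem_qubitsOn, h]

theorem even_card_qubitsOn_inter {d : ℕ} {s : Set Point} {t : Finset Point} :
    Even (qubitsOn d s ∩ qubitsOn d ↑t).card ↔ ∑ v ∈ t, indicator d s v = 0 := by
  rw [even_card_iff_dotProduct, bits_dotProduct, sum_qubitsOn, extend_bits_qubitsOn]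

theorem card_qubitsOn_coe {d : ℕ} {t : Finset Point} (h : t ⊆ latticeVertices d) :
    (qubitsOn d ↑t).card = t.card := by
  refine Finset.card_bij (fun v _ => v.1) (fun v hv => mem_qubitsOn.1 hv)
    (fun u _ v _ => Subtype.ext) (fun v hv => ⟨⟨v, h hv⟩, mem_qubitsOn.2 hv, rfl⟩)

/-! ## Cells and faces of the infinite lattice -/

theorem mem_octahedron {v p : Point} :
    v ∈ octahedron p ↔
      ((v.1 = p.1 - 1 ∨ v.1 = p.1 + 1) ∧ v.2.1 = p.2.1 ∧ v.2.2 = p.2.2) ∨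
      (v.1 = p.1 ∧ (v.2.1 = p.2.1 - 1 ∨ v.2.1 = p.2.1 + 1) ∧ v.2.2 = p.2.2) ∨
      (v.1 = p.1 ∧ v.2.1 = p.2.1 ∧ (v.2.2 = p.2.2 - 1 ∨ v.2.2 = p.2.2 + 1)) := by
  change |v.1 - p.1| + |v.2.1 - p.2.1| + |v.2.2 - p.2.2| = 1 ↔ _
  rcases abs_cases (v.1 - p.1) with h1 | h1 <;> rcases abs_cases (v.2.1 - p.2.1) with h2 | h2 <;>
    rcases abs_cases (v.2.2 - p.2.2) with h3 | h3 <;> rw [h1.1, h2.1, h3.1] <;> omega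

theorem mem_cuboctahedron {v p : Point} :
    v ∈ cuboctahedron p ↔
      (v.1 = p.1 ∧ (v.2.1 = p.2.1 - 1 ∨ v.2.1 = p.2.1 + 1) ∧
        (v.2.2 = p.2.2 - 1 ∨ v.2.2 = p.2.2 + 1)) ∨
      ((v.1 = p.1 - 1 ∨ v.1 = p.1 + 1) ∧ v.2.1 = p.2.1 ∧
        (v.2.2 = p.2.2 - 1 ∨ v.2.2 = p.2.2 + 1)) ∨
      ((v.1 = p.1 - 1 ∨ v.1 = p.1 + 1) ∧ (v.2.1 = p.2.1 - 1 ∨ v.2.1 = p.2.1 + 1) ∧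
        v.2.2 = p.2.2) := by
  change |v.1 - p.1| ≤ 1 ∧ |v.2.1 - p.2.1| ≤ 1 ∧ |v.2.2 - p.2.2| ≤ 1 ∧
    |v.1 - p.1| + |v.2.1 - p.2.1| + |v.2.2 - p.2.2| = 2 ↔ _
  rcases abs_cases (v.1 - p.1) with h1 | h1 <;> rcases abs_cases (v.2.1 - p.2.1) with h2 | h2 <;>
    rcases abs_cases (v.2.2 - p.2.2) with h3 | h3 <;> rw [h1.1, h2.1, h3.1] <;> omega

theorem bounds_of_mem_cuboctahedron {v p : Point} (h : v ∈ cuboctahedron p) :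
    (p.1 - 1 ≤ v.1 ∧ v.1 ≤ p.1 + 1) ∧ (p.2.1 - 1 ≤ v.2.1 ∧ v.2.1 ≤ p.2.1 + 1) ∧
      (p.2.2 - 1 ≤ v.2.2 ∧ v.2.2 ≤ p.2.2 + 1) ∧
      (v.1 = p.1 ∨ v.2.1 = p.2.1 ∨ v.2.2 = p.2.2) := by
  rw [mem_cuboctahedron] at h
  omega

theorem isCentre_green {p : Point} :
    IsCentre .green p ↔ p.1 % 2 = 0 ∧ p.2.1 % 2 = 0 ∧ p.2.2 % 2 = 0 := by
  simp only [IsCentre, Int.even_iff]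

theorem isCentre_red {p : Point} :
    IsCentre .red p ↔ p.1 % 2 = 1 ∧ p.2.1 % 2 = 1 ∧ p.2.2 % 2 = 1 ∧
      (p.1 + p.2.1 + p.2.2) % 4 = 3 := by
  simp only [IsCentre, Int.odd_iff]

theorem isCentre_blue {p : Point} :
    IsCentre .blue p ↔ p.1 % 2 = 1 ∧ p.2.1 % 2 = 1 ∧ p.2.2 % 2 = 1 ∧
      (p.1 + p.2.1 + p.2.2) % 4 = 1 := by
  simp only [IsCentre, Int.odd_iff]

/-- The vertices of the square around `m` on which the coordinate of colour `i` is constant. -/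
def square (i : Colour) (m : Point) : Finset Point :=
  match i with
  | .red => {(m.1, m.2.1 - 1, m.2.2), (m.1, m.2.1 + 1, m.2.2), (m.1, m.2.1, m.2.2 - 1),
      (m.1, m.2.1, m.2.2 + 1)}
  | .blue => {(m.1 - 1, m.2.1, m.2.2), (m.1 + 1, m.2.1, m.2.2), (m.1, m.2.1, m.2.2 - 1),
      (m.1, m.2.1, m.2.2 + 1)}
  | .green => {(m.1 - 1, m.2.1, m.2.2), (m.1 + 1, m.2.1, m.2.2), (m.1, m.2.1 - 1, m.2.2),
      (m.1, m.2.1 + 1, m.2.2)}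

/-- `m` is the centre of a square face with constant coordinate of colour `i`. -/
def IsSquareCentre (i : Colour) (m : Point) : Prop :=
  match i with
  | .red => m.1 % 2 = 0 ∧ m.2.1 % 2 = 1 ∧ m.2.2 % 2 = 1
  | .blue => m.1 % 2 = 1 ∧ m.2.1 % 2 = 0 ∧ m.2.2 % 2 = 1
  | .green => m.1 % 2 = 1 ∧ m.2.1 % 2 = 1 ∧ m.2.2 % 2 = 0

theorem mem_square_red {v m : Point} : v ∈ square .red m ↔
    v.1 = m.1 ∧ (((v.2.1 = m.2.1 - 1 ∨ v.2.1 = m.2.1 + 1) ∧ v.2.2 = m.2.2) ∨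
      (v.2.1 = m.2.1 ∧ (v.2.2 = m.2.2 - 1 ∨ v.2.2 = m.2.2 + 1))) := by
  simp only [square, Finset.mem_insert, Finset.mem_singleton, Prod.ext_iff]
  tauto

theorem mem_square_blue {v m : Point} : v ∈ square .blue m ↔
    v.2.1 = m.2.1 ∧ (((v.1 = m.1 - 1 ∨ v.1 = m.1 + 1) ∧ v.2.2 = m.2.2) ∨
      (v.1 = m.1 ∧ (v.2.2 = m.2.2 - 1 ∨ v.2.2 = m.2.2 + 1))) := by
  simp only [square, Finset.mem_insert, Finset.mem_singleton, Prod.ext_iff]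
  tauto

theorem mem_square_green {v m : Point} : v ∈ square .green m ↔
    v.2.2 = m.2.2 ∧ (((v.1 = m.1 - 1 ∨ v.1 = m.1 + 1) ∧ v.2.1 = m.2.1) ∨
      (v.1 = m.1 ∧ (v.2.1 = m.2.1 - 1 ∨ v.2.1 = m.2.1 + 1))) := by
  simp only [square, Finset.mem_insert, Finset.mem_singleton, Prod.ext_iff]
  tauto

theorem cuboctahedron_inter_red (m : Point) :
    cuboctahedron (m.1 - 1, m.2) ∩ cuboctahedron (m.1 + 1, m.2) = ↑(square .red m) := by
  ext v
  rw [Set.mem_inter_iff, mem_cuboctahedron, mem_cuboctahedron, Finset.mem_coe, mem_square_red]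
  simp only
  omega

theorem cuboctahedron_inter_blue (m : Point) :
    cuboctahedron (m.1, m.2.1 - 1, m.2.2) ∩ cuboctahedron (m.1, m.2.1 + 1, m.2.2) =
      ↑(square .blue m) := by
  ext v
  rw [Set.mem_inter_iff, mem_cuboctahedron, mem_cuboctahedron, Finset.mem_coe, mem_square_blue]
  simp only
  omega

theorem cuboctahedron_inter_green (m : Point) :
    cuboctahedron (m.1, m.2.1, m.2.2 - 1) ∩ cuboctahedron (m.1, m.2.1, m.2.2 + 1) =
      ↑(square .green m) := by
  ext v
  rw [Set.mem_inter_iff, mem_cuboctahedron, mem_cuboctahedron, Finset.mem_coe, mem_square_green]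
  simp only
  omega

theorem isFace_red_blue_of_centre {q r : Point} {f : Set Point} (hf : f.Nonempty)
    (hq : q.1 % 2 = 1 ∧ q.2.1 % 2 = 1 ∧ q.2.2 % 2 = 1)
    (hr : r.1 % 2 = 1 ∧ r.2.1 % 2 = 1 ∧ r.2.2 % 2 = 1)
    (hqr : (q.1 + q.2.1 + q.2.2) % 4 = 3 ∧ (r.1 + r.2.1 + r.2.2) % 4 = 1 ∨
      (q.1 + q.2.1 + q.2.2) % 4 = 1 ∧ (r.1 + r.2.1 + r.2.2) % 4 = 3)
    (h : f = cuboctahedron q ∩ cuboctahedron r) : IsFace .red .blue f := by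
  rcases hqr with hqr | hqr
  · exact ⟨q, r, isCentre_red.2 (by tauto), isCentre_blue.2 (by tauto), h, hf⟩
  · exact ⟨r, q, isCentre_red.2 (by tauto), isCentre_blue.2 (by tauto), by
      rw [h, Set.inter_comm]; rfl, hf⟩

theorem square_nonempty (i : Colour) (m : Point) : (square i m : Set Point).Nonempty := by
  cases i <;> exact ⟨_, Finset.mem_coe.2 (Finset.mem_insert_self _ _)⟩

theorem isFace_red_blue_iff {f : Set Point} :
    IsFace .red .blue f ↔ ∃ i m, IsSquareCentre i m ∧ f = ↑(square i m) := by
  constructor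
  · rintro ⟨q, r, hq, hr, rfl, v, hv⟩
    rw [isCentre_red] at hq
    rw [isCentre_blue] at hr
    change v ∈ cuboctahedron q ∩ cuboctahedron r at hv
    change ∃ i m, IsSquareCentre i m ∧ cuboctahedron q ∩ cuboctahedron r = _
    obtain ⟨a1, a2, a3, a4⟩ := bounds_of_mem_cuboctahedron hv.1
    obtain ⟨b1, b2, b3, -⟩ := bounds_of_mem_cuboctahedron hv.2
    have h1 : r.1 = q.1 ∨ r.1 = q.1 + 2 ∨ r.1 = q.1 - 2 := by
      clear a2 a3 a4 b2 b3
      omega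
    have h2 : r.2.1 = q.2.1 ∨ r.2.1 = q.2.1 + 2 ∨ r.2.1 = q.2.1 - 2 := by
      clear a1 a3 a4 b1 b3 h1
      omega
    have h3 : r.2.2 = q.2.2 ∨ r.2.2 = q.2.2 + 2 ∨ r.2.2 = q.2.2 - 2 := by
      clear a1 a2 a4 b1 b2 h1 h2
      omega
    have hsum : (r.1 - q.1 + (r.2.1 - q.2.1) + (r.2.2 - q.2.2)) % 4 = 2 := by
      clear a1 a2 a3 a4 b1 b2 b3 h1 h2 h3
      omega
    have hne : r.1 = q.1 ∨ r.2.1 = q.2.1 ∨ r.2.2 = q.2.2 := by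
      clear hsum hq hr
      omega
    clear a1 a2 a3 a4 b1 b2 b3
    obtain ⟨q1, q2, q3⟩ := q
    obtain ⟨r1, r2, r3⟩ := r
    simp only at hq hr h1 h2 h3 hsum hne
    rcases h1 with rfl | rfl | rfl <;> rcases h2 with rfl | rfl | rfl <;>
      rcases h3 with rfl | rfl | rfl <;>
      first
      | exact absurd hsum (by omega)
      | exact absurd hne (by omega)
      | skip
    · refine ⟨.green, (r1, r2, q3 + 1), by simp only [IsSquareCentre]; omega, ?_⟩
      rw [← cuboctahedron_inter_green]
      simp only [add_sub_cancel_right, add_assoc, one_add_one_eq_two]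
    · refine ⟨.green, (r1, r2, q3 - 1), by simp only [IsSquareCentre]; omega, ?_⟩
      rw [← cuboctahedron_inter_green, Set.inter_comm]
      simp only [sub_add_cancel, sub_sub, one_add_one_eq_two]
    · refine ⟨.blue, (r1, q2 + 1, r3), by simp only [IsSquareCentre]; omega, ?_⟩
      rw [← cuboctahedron_inter_blue]
      simp only [add_sub_cancel_right, add_assoc, one_add_one_eq_two]
    · refine ⟨.blue, (r1, q2 - 1, r3), by simp only [IsSquareCentre]; omega, ?_⟩
      rw [← cuboctahedron_inter_blue, Set.inter_comm]
      simp only [sub_add_cancel, sub_sub, one_add_one_eq_two]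
    · refine ⟨.red, (q1 + 1, r2, r3), by simp only [IsSquareCentre]; omega, ?_⟩
      rw [← cuboctahedron_inter_red]
      simp only [add_sub_cancel_right, add_assoc, one_add_one_eq_two]
    · refine ⟨.red, (q1 - 1, r2, r3), by simp only [IsSquareCentre]; omega, ?_⟩
      rw [← cuboctahedron_inter_red, Set.inter_comm]
      simp only [sub_add_cancel, sub_sub, one_add_one_eq_two]
  · rintro ⟨i, m, hm, rfl⟩
    cases i
    · refine isFace_red_blue_of_centre (square_nonempty _ _) ?_ ?_ ?_
        (cuboctahedron_inter_red m).symm <;> simp only [IsSquareCentre] at hm ⊢ <;> omega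
    · refine isFace_red_blue_of_centre (square_nonempty _ _) ?_ ?_ ?_
        (cuboctahedron_inter_green m).symm <;> simp only [IsSquareCentre] at hm ⊢ <;> omega
    · refine isFace_red_blue_of_centre (square_nonempty _ _) ?_ ?_ ?_
        (cuboctahedron_inter_blue m).symm <;> simp only [IsSquareCentre] at hm ⊢ <;> omega

/-- The vertices which the octahedron around `p` shares with the cuboctahedron around `q`, if
the difference of `p` and `q` is `±1` in each coordinate. -/
def triangle (p q : Point) : Finset Point :=
  {(q.1, p.2.1, p.2.2), (p.1, q.2.1, p.2.2), (p.1, p.2.1, q.2.2)}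

/-- The difference of `p` and `q` is `±1` in each coordinate. -/
def IsCorner (p q : Point) : Prop :=
  (q.1 = p.1 - 1 ∨ q.1 = p.1 + 1) ∧ (q.2.1 = p.2.1 - 1 ∨ q.2.1 = p.2.1 + 1) ∧
    (q.2.2 = p.2.2 - 1 ∨ q.2.2 = p.2.2 + 1)

theorem mem_triangle {v p q : Point} : v ∈ triangle p q ↔
    (v.1 = q.1 ∧ v.2.1 = p.2.1 ∧ v.2.2 = p.2.2) ∨ (v.1 = p.1 ∧ v.2.1 = q.2.1 ∧ v.2.2 = p.2.2) ∨
      (v.1 = p.1 ∧ v.2.1 = p.2.1 ∧ v.2.2 = q.2.2) := by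
  simp only [triangle, Finset.mem_insert, Finset.mem_singleton, Prod.ext_iff]

theorem cuboctahedron_inter_octahedron {p q : Point} (h : IsCorner p q) :
    cuboctahedron q ∩ octahedron p = ↑(triangle p q) := by
  ext v
  rw [Set.mem_inter_iff, mem_cuboctahedron, mem_octahedron, Finset.mem_coe, mem_triangle]
  unfold IsCorner at h
  omega

theorem cell_of_ne_green {c : Colour} (hc : c ≠ .green) (p : Point) :
    cell c p = cuboctahedron p := by
  cases c <;> first | rfl | exact absurd rfl hc

theorem isCentre_odd {c : Colour} (hc : c ≠ .green) {q : Point} (hq : IsCentre c q) :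
    q.1 % 2 = 1 ∧ q.2.1 % 2 = 1 ∧ q.2.2 % 2 = 1 := by
  cases c
  · rw [isCentre_red] at hq
    tauto
  · exact absurd rfl hc
  · rw [isCentre_blue] at hq
    tauto

theorem isFace_green_iff {c : Colour} (hc : c ≠ .green) {f : Set Point} :
    IsFace c .green f ↔ ∃ p q, IsCentre .green p ∧ IsCentre c q ∧ IsCorner p q ∧
      f = ↑(triangle p q) := by
  constructor
  · rintro ⟨q, p, hq, hp, rfl, v, hv⟩
    rw [cell_of_ne_green hc]
    rw [cell_of_ne_green hc] at hv
    change v ∈ cuboctahedron q ∩ octahedron p at hv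
    have hcorner : IsCorner p q := by
      rw [Set.mem_inter_iff, mem_cuboctahedron, mem_octahedron] at hv
      have := isCentre_odd hc hq
      rw [isCentre_green] at hp
      unfold IsCorner
      omega
    exact ⟨p, q, hp, hq, hcorner, cuboctahedron_inter_octahedron hcorner⟩
  · rintro ⟨p, q, hp, hq, hpq, rfl⟩
    refine ⟨q, p, hq, hp, ?_, ⟨_, Finset.mem_coe.2 (Finset.mem_insert_self _ _)⟩⟩
    rw [cell_of_ne_green hc]
    exact (cuboctahedron_inter_octahedron hpq).symm

/-! ## Counting -/

/-- The integers `a, a + 2, …, a + 2 (n - 1)`. -/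
def steps (a : ℤ) (n : ℕ) : Finset ℤ :=
  (Finset.range n).map ⟨fun k : ℕ => a + 2 * (k : ℤ), fun j k h => by simpa using h⟩

theorem mem_steps {a x : ℤ} {n : ℕ} :
    x ∈ steps a n ↔ a ≤ x ∧ x < a + 2 * n ∧ (x - a) % 2 = 0 := by
  rw [steps, Finset.mem_map]
  change (∃ k ∈ Finset.range n, a + 2 * (k : ℤ) = x) ↔ _
  simp only [Finset.mem_range]
  constructor
  · rintro ⟨k, hk, rfl⟩
    omega
  · intro h
    exact ⟨((x - a) / 2).toNat, by omega, by omega⟩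

theorem card_steps (a : ℤ) (n : ℕ) : (steps a n).card = n := by
  simp [steps]

theorem latticeVertices_eq (d : ℕ) (hd : 2 ≤ d) : latticeVertices d =
    (steps 1 (d - 1) ×ˢ steps 0 d ×ˢ steps 2 (d - 1) ∪
      steps 0 d ×ˢ steps 1 (d - 1) ×ˢ steps 2 (d - 1)) ∪ steps 0 d ×ˢ steps 0 d ×ˢ steps 1 d := by
  ext v
  simp only [mem_latticeVertices, isVertex_iff, Finset.mem_union, Finset.mem_product, mem_steps]
  rcases Int.emod_two_eq_zero_or_one v.1 with h1 | h1 <;>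
    rcases Int.emod_two_eq_zero_or_one v.2.1 with h2 | h2 <;>
      rcases Int.emod_two_eq_zero_or_one v.2.2 with h3 | h3 <;> omega

theorem card_qubit (d : ℕ) (hd : 2 ≤ d) :
    (Fintype.card (Qubit d) : ℚ) = 3 * (d : ℚ) ^ 3 - 4 * (d : ℚ) ^ 2 + 2 * (d : ℚ) := by
  rw [Fintype.card_coe, latticeVertices_eq d hd, Finset.card_union_of_disjoint,
    Finset.card_union_of_disjoint]
  · simp only [Finset.card_product, card_steps]
    push_cast [Nat.cast_sub (show 1 ≤ d by omega)]
    ring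
  · refine Finset.disjoint_left.2 fun v => ?_
    simp only [Finset.mem_product, mem_steps]
    omega
  · refine Finset.disjoint_left.2 fun v => ?_
    simp only [Finset.mem_union, Finset.mem_product, mem_steps]
    omega

/-- The value of the coordinate of colour `c` on the boundaries of colour `c`. -/
def side (d : ℕ) (c : Colour) (high : Bool) : ℤ :=
  coord c (if high then highCorner d else lowCorner)

theorem mem_boundary {d : ℕ} {c : Colour} {high : Bool} {v : Qubit d} :
    v ∈ boundary d c high ↔ coord c v.1 = side d c high := by
  rw [boundary, mem_qubitsOn]
  rfl

theorem side_red (d : ℕ) (s : Bool) : side d .red s = 0 ∨ side d .red s = 2 * d - 2 := by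
  cases s <;> simp [side, coord, lowCorner, highCorner]

theorem side_blue (d : ℕ) (s : Bool) : side d .blue s = 0 ∨ side d .blue s = 2 * d - 2 := by
  cases s <;> simp [side, coord, lowCorner, highCorner]

theorem side_green (d : ℕ) (s : Bool) : side d .green s = 1 ∨ side d .green s = 2 * d - 1 := by
  cases s <;> simp [side, coord, lowCorner, highCorner]

theorem boundary_eq (d : ℕ) (c : Colour) (s : Bool) :
    boundary d c s = qubitsOn d {v | coord c v = side d c s} := rfl

theorem eq_qubitsOn_coe {d : ℕ} {s : Finset (Qubit d)} {t : Finset Point}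
    (h : ∀ v : Qubit d, v ∈ s ↔ v.1 ∈ t) : s = qubitsOn d ↑t := by
  ext v
  rw [h, mem_qubitsOn, Finset.mem_coe]

theorem canonicalZ_comm (d : ℕ) (c₁ c₂ : Colour) (s₁ s₂ : Bool) :
    canonicalZ d c₁ c₂ s₁ s₂ = canonicalZ d c₂ c₁ s₂ s₁ := Finset.inter_comm _ _

theorem canonicalZ_red_blue (d : ℕ) (s₁ s₂ : Bool) : canonicalZ d .red .blue s₁ s₂ =
    qubitsOn d ↑(({side d .red s₁} : Finset ℤ) ×ˢ ({side d .blue s₂} : Finset ℤ) ×ˢ steps 1 d) := by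
  refine eq_qubitsOn_coe fun v => ?_
  have hv := mem_latticeVertices.1 v.2
  rw [isVertex_iff] at hv
  simp only [canonicalZ, Finset.mem_inter, mem_boundary, Finset.mem_product,
    Finset.mem_singleton, mem_steps, coord]
  have h1 := side_red d s₁
  have h2 := side_blue d s₂
  omega

theorem canonicalZ_red_green (d : ℕ) (s₁ s₂ : Bool) : canonicalZ d .red .green s₁ s₂ =
    qubitsOn d ↑(({side d .red s₁} : Finset ℤ) ×ˢ steps 0 d ×ˢ
      ({side d .green s₂} : Finset ℤ)) := by
  refine eq_qubitsOn_coe fun v => ?_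
  have hv := mem_latticeVertices.1 v.2
  rw [isVertex_iff] at hv
  simp only [canonicalZ, Finset.mem_inter, mem_boundary, Finset.mem_product,
    Finset.mem_singleton, mem_steps, coord]
  have h1 := side_red d s₁
  have h2 := side_green d s₂
  omega

theorem canonicalZ_blue_green (d : ℕ) (s₁ s₂ : Bool) : canonicalZ d .blue .green s₁ s₂ =
    qubitsOn d ↑(steps 0 d ×ˢ ({side d .blue s₁} : Finset ℤ) ×ˢ
      ({side d .green s₂} : Finset ℤ)) := by
  refine eq_qubitsOn_coe fun v => ?_
  have hv := mem_latticeVertices.1 v.2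
  rw [isVertex_iff] at hv
  simp only [canonicalZ, Finset.mem_inter, mem_boundary, Finset.mem_product,
    Finset.mem_singleton, mem_steps, coord]
  have h1 := side_blue d s₁
  have h2 := side_green d s₂
  omega

theorem card_canonicalZ_red_blue (d : ℕ) (s₁ s₂ : Bool) :
    (canonicalZ d .red .blue s₁ s₂).card = d := by
  rw [canonicalZ_red_blue, card_qubitsOn_coe]
  · simp [card_steps]
  · intro v
    simp only [Finset.mem_product, Finset.mem_singleton, mem_steps, mem_latticeVertices,
      isVertex_iff]
    have h1 := side_red d s₁
    have h2 := side_blue d s₂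
    omega

theorem card_canonicalZ_red_green (d : ℕ) (s₁ s₂ : Bool) :
    (canonicalZ d .red .green s₁ s₂).card = d := by
  rw [canonicalZ_red_green, card_qubitsOn_coe]
  · simp [card_steps]
  · intro v
    simp only [Finset.mem_product, Finset.mem_singleton, mem_steps, mem_latticeVertices,
      isVertex_iff]
    have h1 := side_red d s₁
    have h2 := side_green d s₂
    omega

theorem card_canonicalZ_blue_green (d : ℕ) (s₁ s₂ : Bool) :
    (canonicalZ d .blue .green s₁ s₂).card = d := by
  rw [canonicalZ_blue_green, card_qubitsOn_coe]
  · simp [card_steps]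
  · intro v
    simp only [Finset.mem_product, Finset.mem_singleton, mem_steps, mem_latticeVertices,
      isVertex_iff]
    have h1 := side_blue d s₁
    have h2 := side_green d s₂
    omega

theorem card_canonicalZ (d : ℕ) (c₁ c₂ : Colour) (h : c₁ ≠ c₂) (s₁ s₂ : Bool) :
    (canonicalZ d c₁ c₂ s₁ s₂).card = d := by
  cases c₁ <;> cases c₂
  · exact absurd rfl h
  · exact card_canonicalZ_red_green d s₁ s₂
  · exact card_canonicalZ_red_blue d s₁ s₂
  · exact (congrArg _ (canonicalZ_comm d .green .red s₁ s₂)).trans (card_canonicalZ_red_green d s₂ s₁)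
  · exact absurd rfl h
  · exact (congrArg _ (canonicalZ_comm d .green .blue s₁ s₂)).trans (card_canonicalZ_blue_green d s₂ s₁)
  · exact (congrArg _ (canonicalZ_comm d .blue .red s₁ s₂)).trans (card_canonicalZ_red_blue d s₂ s₁)
  · exact card_canonicalZ_blue_green d s₁ s₂
  · exact absurd rfl h

theorem card_canonicalX_green (d : ℕ) (s : Bool) :
    (canonicalX d .green s).card = d ^ 2 := by
  have : canonicalX d .green s =
      qubitsOn d ↑(steps 0 d ×ˢ steps 0 d ×ˢ ({side d .green s} : Finset ℤ)) := by
    refine eq_qubitsOn_coe fun v => ?_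
    have hv := mem_latticeVertices.1 v.2
    rw [isVertex_iff] at hv
    simp only [canonicalX, mem_boundary, Finset.mem_product,
      Finset.mem_singleton, mem_steps, coord]
    have h1 := side_green d s
    omega
  rw [this, card_qubitsOn_coe]
  · simp [card_steps, sq]
  · intro v
    simp only [Finset.mem_product, Finset.mem_singleton, mem_steps, mem_latticeVertices,
      isVertex_iff]
    have h1 := side_green d s
    omega

theorem canonicalX_red (d : ℕ) (hd : 2 ≤ d) (s : Bool) : canonicalX d .red s =
    qubitsOn d ↑((({side d .red s} : Finset ℤ) ×ˢ steps 0 d ×ˢ steps 1 d) ∪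
      (({side d .red s} : Finset ℤ) ×ˢ steps 1 (d - 1) ×ˢ steps 2 (d - 1))) := by
  refine eq_qubitsOn_coe fun v => ?_
  obtain ⟨⟨h1, h2, h3⟩, hv⟩ := mem_latticeVertices.1 v.2
  rw [isVertex_iff] at hv
  have hs := side_red d s
  simp only [canonicalX, mem_boundary, Finset.mem_product, Finset.mem_union,
    Finset.mem_singleton, mem_steps, coord]
  constructor
  · intro h
    rcases hv with hv | hv | hv
    · exact absurd h (by omega)
    · exact Or.inr (by omega)
    · exact Or.inl (by omega)
  · omega

theorem card_canonicalX_red (d : ℕ) (hd : 2 ≤ d) (s : Bool) :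
    (canonicalX d .red s).card = d ^ 2 + (d - 1) ^ 2 := by
  rw [canonicalX_red d hd, card_qubitsOn_coe, Finset.card_union_of_disjoint]
  · simp [card_steps, sq]
  · refine Finset.disjoint_left.2 fun v => ?_
    simp only [Finset.mem_product, mem_steps]
    omega
  · have hs := side_red d s
    refine Finset.union_subset ?_ ?_ <;> intro v <;>
      simp only [Finset.mem_product, Finset.mem_singleton, mem_steps, mem_latticeVertices,
        isVertex_iff] <;> omega

theorem canonicalX_blue (d : ℕ) (hd : 2 ≤ d) (s : Bool) : canonicalX d .blue s =
    qubitsOn d ↑((steps 0 d ×ˢ ({side d .blue s} : Finset ℤ) ×ˢ steps 1 d) ∪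
      (steps 1 (d - 1) ×ˢ ({side d .blue s} : Finset ℤ) ×ˢ steps 2 (d - 1))) := by
  refine eq_qubitsOn_coe fun v => ?_
  obtain ⟨⟨h1, h2, h3⟩, hv⟩ := mem_latticeVertices.1 v.2
  rw [isVertex_iff] at hv
  have hs := side_blue d s
  simp only [canonicalX, mem_boundary, Finset.mem_product, Finset.mem_union,
    Finset.mem_singleton, mem_steps, coord]
  constructor
  · intro h
    rcases hv with hv | hv | hv
    · exact Or.inr (by omega)
    · exact absurd h (by omega)
    · exact Or.inl (by omega)
  · omega

theorem card_canonicalX_blue (d : ℕ) (hd : 2 ≤ d) (s : Bool) :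
    (canonicalX d .blue s).card = d ^ 2 + (d - 1) ^ 2 := by
  rw [canonicalX_blue d hd, card_qubitsOn_coe, Finset.card_union_of_disjoint]
  · simp [card_steps, sq]
  · refine Finset.disjoint_left.2 fun v => ?_
    simp only [Finset.mem_product, mem_steps]
    omega
  · have hs := side_blue d s
    refine Finset.union_subset ?_ ?_ <;> intro v <;>
      simp only [Finset.mem_product, Finset.mem_singleton, mem_steps, mem_latticeVertices,
        isVertex_iff] <;> omega

/-! ## The green code -/

theorem sum_square_red {M : Type} [AddCommMonoid M] (f : Point → M) (m : Point) :
    ∑ v ∈ square .red m, f v = f (m.1, m.2.1 - 1, m.2.2) + (f (m.1, m.2.1 + 1, m.2.2) +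
      (f (m.1, m.2.1, m.2.2 - 1) + f (m.1, m.2.1, m.2.2 + 1))) := by
  rw [square, Finset.sum_insert, Finset.sum_insert, Finset.sum_insert, Finset.sum_singleton] <;>
    simp only [Finset.mem_insert, Finset.mem_singleton, Prod.mk.injEq] <;> omega

theorem sum_square_blue {M : Type} [AddCommMonoid M] (f : Point → M) (m : Point) :
    ∑ v ∈ square .blue m, f v = f (m.1 - 1, m.2.1, m.2.2) + (f (m.1 + 1, m.2.1, m.2.2) +
      (f (m.1, m.2.1, m.2.2 - 1) + f (m.1, m.2.1, m.2.2 + 1))) := by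
  rw [square, Finset.sum_insert, Finset.sum_insert, Finset.sum_insert, Finset.sum_singleton] <;>
    simp only [Finset.mem_insert, Finset.mem_singleton, Prod.mk.injEq] <;> omega

theorem sum_square_green {M : Type} [AddCommMonoid M] (f : Point → M) (m : Point) :
    ∑ v ∈ square .green m, f v = f (m.1 - 1, m.2.1, m.2.2) + (f (m.1 + 1, m.2.1, m.2.2) +
      (f (m.1, m.2.1 - 1, m.2.2) + f (m.1, m.2.1 + 1, m.2.2))) := by
  rw [square, Finset.sum_insert, Finset.sum_insert, Finset.sum_insert, Finset.sum_singleton] <;>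
    simp only [Finset.mem_insert, Finset.mem_singleton, Prod.mk.injEq] <;> omega

theorem mem_box_of_mem_square {d : ℕ} {i : Colour} {m u v : Point} (hm : IsSquareCentre i m)
    (hu : u ∈ square i m) (hv : v ∈ square i m) (huv : u ≠ v)
    (hu' : u ∈ Set.Icc lowCorner (highCorner d)) (hv' : v ∈ Set.Icc lowCorner (highCorner d)) :
    m ∈ Set.Icc lowCorner (highCorner d) := by
  rw [mem_box_iff] at *
  rw [Ne, Prod.ext_iff, Prod.ext_iff] at huv
  cases i
  · rw [mem_square_red] at hu hv
    simp only [IsSquareCentre] at hm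
    omega
  · rw [mem_square_green] at hu hv
    simp only [IsSquareCentre] at hm
    omega
  · rw [mem_square_blue] at hu hv
    simp only [IsSquareCentre] at hm
    omega

theorem three_le_card_square {d : ℕ} (hd : 2 ≤ d) {i : Colour} {m : Point}
    (hm : IsSquareCentre i m) (hbox : m ∈ Set.Icc lowCorner (highCorner d)) :
    3 ≤ (qubitsOn d ↑(square i m)).card := by
  rw [three_le_card_qubitsOn_iff]
  rw [mem_box_iff] at hbox
  cases i <;> simp only [IsSquareCentre] at hm
  · refine ⟨(m.1, m.2.1 - 1, m.2.2), ?_, (m.1, m.2.1 + 1, m.2.2), ?_,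
      (m.1, m.2.1, if m.2.2 = 1 then 2 else m.2.2 - 1), ?_, ?_⟩
    · rw [mem_latticeVertices, isVertex_iff]
      simp only
      omega
    · rw [mem_latticeVertices, isVertex_iff]
      simp only
      omega
    · rw [mem_latticeVertices, isVertex_iff]
      simp only
      split_ifs <;> omega
    · simp only [Finset.mem_coe, mem_square_red, ne_eq, Prod.mk.injEq, true_and, and_true,
        true_or, or_true]
      split_ifs <;> omega
  · refine ⟨(m.1 - 1, m.2.1, m.2.2), ?_, (m.1 + 1, m.2.1, m.2.2), ?_,
      (m.1, m.2.1 + 1, m.2.2), ?_, ?_⟩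
    · rw [mem_latticeVertices, isVertex_iff]
      simp only
      omega
    · rw [mem_latticeVertices, isVertex_iff]
      simp only
      omega
    · rw [mem_latticeVertices, isVertex_iff]
      simp only
      omega
    · simp only [Finset.mem_coe, mem_square_green, ne_eq, Prod.mk.injEq, true_and, and_true,
        true_or, or_true]
      omega
  · refine ⟨(m.1 - 1, m.2.1, m.2.2), ?_, (m.1 + 1, m.2.1, m.2.2), ?_,
      (m.1, m.2.1, if m.2.2 = 1 then 2 else m.2.2 - 1), ?_, ?_⟩
    · rw [mem_latticeVertices, isVertex_iff]
      simp only
      omega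
    · rw [mem_latticeVertices, isVertex_iff]
      simp only
      omega
    · rw [mem_latticeVertices, isVertex_iff]
      simp only
      split_ifs <;> omega
    · simp only [Finset.mem_coe, mem_square_blue, ne_eq, Prod.mk.injEq, true_and, and_true,
        true_or, or_true]
      split_ifs <;> omega

theorem zSupports_green (d : ℕ) (hd : 2 ≤ d) : zSupports d .green =
    {s | ∃ i m, IsSquareCentre i m ∧ m ∈ Set.Icc lowCorner (highCorner d) ∧
      s = qubitsOn d ↑(square i m)} := by
  ext s
  change (∃ f, IsFace .red .blue f ∧ s = qubitsOn d f ∧ 3 ≤ s.card) ↔ _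
  constructor
  · rintro ⟨f, hf, rfl, hcard⟩
    obtain ⟨i, m, hm, rfl⟩ := isFace_red_blue_iff.1 hf
    obtain ⟨u, hu, v, hv, -, -, hu', hv', -, huv, -⟩ := three_le_card_qubitsOn_iff.1 hcard
    exact ⟨i, m, hm, mem_box_of_mem_square hm hu' hv' huv
      (mem_box_iff.2 (mem_latticeVertices.1 hu).1)
      (mem_box_iff.2 (mem_latticeVertices.1 hv).1), rfl⟩
  · rintro ⟨i, m, hm, hbox, rfl⟩
    exact ⟨_, isFace_red_blue_iff.2 ⟨i, m, hm, rfl⟩, rfl, three_le_card_square hd hm hbox⟩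

/-- The centres of the green cells of the finite lattice. -/
def greenCentres (d : ℕ) : Finset Point := steps 0 d ×ˢ steps 0 d ×ˢ steps 2 (d - 1)

theorem mem_greenCentres {d : ℕ} (hd : 2 ≤ d) {p : Point} : p ∈ greenCentres d ↔
    IsCentre .green p ∧ p ∈ Set.Icc lowCorner (highCorner d) := by
  simp only [greenCentres, Finset.mem_product, mem_steps, isCentre_green, mem_box_iff]
  omega

theorem card_greenCentres (d : ℕ) (hd : 2 ≤ d) :
    (Fintype.card (greenCentres d) : ℚ) = (d : ℚ) ^ 2 * ((d : ℚ) - 1) := by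
  rw [Fintype.card_coe]
  simp only [greenCentres, Finset.card_product, card_steps]
  push_cast [Nat.cast_sub (show 1 ≤ d by omega)]
  ring

theorem indicator_of_imp {d : ℕ} {s : Set Point} {v : Point} [Decidable (v ∈ s)]
    (h : v ∈ s → v ∈ latticeVertices d) : indicator d s v = if v ∈ s then 1 else 0 := by
  by_cases hv : v ∈ s <;> simp [indicator, hv, h]

theorem mem_latticeVertices_of_octahedron {d : ℕ} {p m : Point} {i : Colour}
    (hp : IsCentre .green p)
    (hp' : p ∈ Set.Icc lowCorner (highCorner d)) (hm : IsSquareCentre i m)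
    (hm' : m ∈ Set.Icc lowCorner (highCorner d)) {v : Point} (hv : v ∈ square i m)
    (hvp : v ∈ octahedron p) : v ∈ latticeVertices d := by
  rw [isCentre_green] at hp
  rw [mem_box_iff] at hp' hm'
  rw [mem_octahedron] at hvp
  rw [mem_latticeVertices, isVertex_iff]
  cases i <;> simp only [IsSquareCentre] at hm
  · rw [mem_square_red] at hv
    rcases hvp with h | h | h <;> omega
  · rw [mem_square_green] at hv
    rcases hvp with h | h | h <;> omega
  · rw [mem_square_blue] at hv
    rcases hvp with h | h | h <;> omega

theorem sum_square_red_octahedron [∀ p : Point, DecidablePred (· ∈ octahedron p)] {p m : Point}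
    (hp : IsCentre .green p) (hm : IsSquareCentre .red m) :
    ∑ v ∈ square .red m, (if v ∈ octahedron p then 1 else 0 : ZMod 2) = 0 := by
  rw [isCentre_green] at hp
  simp only [IsSquareCentre] at hm
  rw [sum_square_red]
  simp only [mem_octahedron]
  by_cases h : m.1 = p.1 ∧ (m.2.1 = p.2.1 - 1 ∨ m.2.1 = p.2.1 + 1) ∧
    (m.2.2 = p.2.2 - 1 ∨ m.2.2 = p.2.2 + 1)
  · obtain ⟨h1, h2 | h2, h3 | h3⟩ := h
    · rw [if_neg (by omega), if_pos (by omega), if_neg (by omega), if_pos (by omega)]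
      decide
    · rw [if_neg (by omega), if_pos (by omega), if_pos (by omega), if_neg (by omega)]
      decide
    · rw [if_pos (by omega), if_neg (by omega), if_neg (by omega), if_pos (by omega)]
      decide
    · rw [if_pos (by omega), if_neg (by omega), if_pos (by omega), if_neg (by omega)]
      decide
  · rw [if_neg (by omega), if_neg (by omega), if_neg (by omega), if_neg (by omega)]
    decide

theorem sum_square_green_octahedron [∀ p : Point, DecidablePred (· ∈ octahedron p)] {p m : Point}
    (hp : IsCentre .green p) (hm : IsSquareCentre .green m) :
    ∑ v ∈ square .green m, (if v ∈ octahedron p then 1 else 0 : ZMod 2) = 0 := by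
  rw [isCentre_green] at hp
  simp only [IsSquareCentre] at hm
  rw [sum_square_green]
  simp only [mem_octahedron]
  by_cases h : m.2.2 = p.2.2 ∧ (m.1 = p.1 - 1 ∨ m.1 = p.1 + 1) ∧
    (m.2.1 = p.2.1 - 1 ∨ m.2.1 = p.2.1 + 1)
  · obtain ⟨h1, h2 | h2, h3 | h3⟩ := h
    · rw [if_neg (by omega), if_pos (by omega), if_neg (by omega), if_pos (by omega)]
      decide
    · rw [if_neg (by omega), if_pos (by omega), if_pos (by omega), if_neg (by omega)]
      decide
    · rw [if_pos (by omega), if_neg (by omega), if_neg (by omega), if_pos (by omega)]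
      decide
    · rw [if_pos (by omega), if_neg (by omega), if_pos (by omega), if_neg (by omega)]
      decide
  · rw [if_neg (by omega), if_neg (by omega), if_neg (by omega), if_neg (by omega)]
    decide

theorem sum_square_blue_octahedron [∀ p : Point, DecidablePred (· ∈ octahedron p)] {p m : Point}
    (hp : IsCentre .green p) (hm : IsSquareCentre .blue m) :
    ∑ v ∈ square .blue m, (if v ∈ octahedron p then 1 else 0 : ZMod 2) = 0 := by
  rw [isCentre_green] at hp
  simp only [IsSquareCentre] at hm
  rw [sum_square_blue]
  simp only [mem_octahedron]
  by_cases h : m.2.1 = p.2.1 ∧ (m.1 = p.1 - 1 ∨ m.1 = p.1 + 1) ∧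
    (m.2.2 = p.2.2 - 1 ∨ m.2.2 = p.2.2 + 1)
  · obtain ⟨h1, h2 | h2, h3 | h3⟩ := h
    · rw [if_neg (by omega), if_pos (by omega), if_neg (by omega), if_pos (by omega)]
      decide
    · rw [if_neg (by omega), if_pos (by omega), if_pos (by omega), if_neg (by omega)]
      decide
    · rw [if_pos (by omega), if_neg (by omega), if_neg (by omega), if_pos (by omega)]
      decide
    · rw [if_pos (by omega), if_neg (by omega), if_pos (by omega), if_neg (by omega)]
      decide
  · rw [if_neg (by omega), if_neg (by omega), if_neg (by omega), if_neg (by omega)]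
    decide

theorem sum_square_octahedron {d : ℕ} {p m : Point} {i : Colour} (hp : IsCentre .green p)
    (hp' : p ∈ Set.Icc lowCorner (highCorner d)) (hm : IsSquareCentre i m)
    (hm' : m ∈ Set.Icc lowCorner (highCorner d)) :
    ∑ v ∈ square i m, indicator d (octahedron p) v = 0 := by
  classical
  rw [Finset.sum_congr rfl fun v hv => indicator_of_imp
    (mem_latticeVertices_of_octahedron hp hp' hm hm' hv)]
  cases i
  · exact sum_square_red_octahedron hp hm
  · exact sum_square_green_octahedron hp hm
  · exact sum_square_blue_octahedron hp hm

theorem sum_square_side {d : ℕ} {s : Bool} {m : Point} {i : Colour} (hm : IsSquareCentre i m)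
    (hm' : m ∈ Set.Icc lowCorner (highCorner d)) :
    ∑ v ∈ square i m, indicator d {v | coord .green v = side d .green s} v = 0 := by
  rw [mem_box_iff] at hm'
  have hs := side_green d s
  cases i <;> simp only [IsSquareCentre] at hm
  · rw [sum_square_red]
    simp only [indicator, mem_latticeVertices, isVertex_iff, Set.mem_ofPred_eq, coord]
    split_ifs <;> first | decide | (exfalso; omega)
  · rw [sum_square_green]
    simp only [indicator, mem_latticeVertices, isVertex_iff, Set.mem_ofPred_eq, coord]
    split_ifs <;> first | decide | (exfalso; omega)
  · rw [sum_square_blue]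
    simp only [indicator, mem_latticeVertices, isVertex_iff, Set.mem_ofPred_eq, coord]
    split_ifs <;> first | decide | (exfalso; omega)

section GreenKernel

variable {d : ℕ} {F : Point → ZMod 2}

theorem green_horizontal_eq_zero (hd : 2 ≤ d) (hout : ∀ v, v ∉ latticeVertices d → F v = 0)
    (hsq : ∀ i m, IsSquareCentre i m → m ∈ Set.Icc lowCorner (highCorner d) →
      ∑ v ∈ square i m, F v = 0)
    (hpivot : ∀ p ∈ greenCentres d, F (p.1, p.2.1, p.2.2 - 1) = 0) (k : ℕ) (hk : k < d)
    (x y : ℤ) (hx : 0 ≤ x ∧ x ≤ 2 * d - 2) (hy : 0 ≤ y ∧ y ≤ 2 * d - 2)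
    (hxy : x % 2 = 1 ∧ y % 2 = 0 ∨ x % 2 = 0 ∧ y % 2 = 1) : F (x, y, 2 * k) = 0 := by
  have hpivot' : ∀ x y z : ℤ, 0 ≤ x → x ≤ 2 * d - 2 → x % 2 = 0 → 0 ≤ y → y ≤ 2 * d - 2 →
      y % 2 = 0 → 1 ≤ z → z ≤ 2 * d - 3 → z % 2 = 1 → F (x, y, z) = 0 := by
    intro x y z _ _ _ _ _ _ _ _ _
    have := hpivot (x, y, z + 1) (by
      rw [mem_greenCentres hd, isCentre_green, mem_box_iff]
      simp only
      omega)
    rwa [add_sub_cancel_right] at this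
  induction k with
  | zero =>
    refine hout _ fun h => ?_
    have := (mem_latticeVertices.1 h).1.2.2.1
    simp at this
  | succ k ih =>
    have ih := ih (by omega)
    have hz : (2 * ((k + 1 : ℕ) : ℤ)) = 2 * k + 1 + 1 := by push_cast; ring
    rw [hz]
    rcases hxy with hxy | hxy
    · have h := hsq .blue (x, y, 2 * k + 1) (by simp only [IsSquareCentre]; omega)
        (by rw [mem_box_iff]; simp only; omega)
      rw [sum_square_blue] at h
      simp only [add_sub_cancel_right] at h
      rwa [ih, hpivot' (x - 1), hpivot' (x + 1), zero_add, zero_add, zero_add] at h <;> omega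
    · have h := hsq .red (x, y, 2 * k + 1) (by simp only [IsSquareCentre]; omega)
        (by rw [mem_box_iff]; simp only; omega)
      rw [sum_square_red] at h
      simp only [add_sub_cancel_right] at h
      rwa [ih, hpivot' _ (y - 1), hpivot' _ (y + 1), zero_add, zero_add, zero_add] at h <;> omega

theorem green_top_eq (hd : 2 ≤ d) (hout : ∀ v, v ∉ latticeVertices d → F v = 0)
    (hsq : ∀ i m, IsSquareCentre i m → m ∈ Set.Icc lowCorner (highCorner d) →
      ∑ v ∈ square i m, F v = 0)
    (hpivot : ∀ p ∈ greenCentres d, F (p.1, p.2.1, p.2.2 - 1) = 0) (a b : ℕ) (ha : a < d)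
    (hb : b < d) : F (2 * a, 2 * b, 2 * d - 1) = F (0, 0, 2 * d - 1) := by
  have hhor := green_horizontal_eq_zero hd hout hsq hpivot (d - 1) (by omega)
  have hz : (2 * ((d - 1 : ℕ) : ℤ)) = 2 * d - 1 - 1 := by omega
  rw [hz] at hhor
  have hout' : ∀ x y : ℤ, F (x, y, 2 * d - 1 + 1) = 0 := fun x y => by
    refine hout _ fun h => ?_
    have := (mem_latticeVertices.1 h).1.2.2.2
    simp at this
  induction a with
  | zero =>
    induction b with
    | zero => simp
    | succ b ih =>
      rw [← ih (by omega)]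
      have h := hsq .red (0, 2 * b + 1, 2 * d - 1) (by simp only [IsSquareCentre]; omega)
        (by rw [mem_box_iff]; simp only; omega)
      rw [sum_square_red] at h
      simp only at h
      rw [hhor _ _ (by omega) (by omega) (by omega), hout', add_zero, add_zero,
        add_sub_cancel_right] at h
      have hb' : (2 * ((b + 1 : ℕ) : ℤ)) = 2 * b + 1 + 1 := by push_cast; ring
      rw [hb']
      simpa using (CharTwo.add_eq_zero.1 h).symm
  | succ a ih =>
    rw [← ih (by omega)]
    have h := hsq .blue (2 * a + 1, 2 * b, 2 * d - 1) (by simp only [IsSquareCentre]; omega)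
      (by rw [mem_box_iff]; simp only; omega)
    rw [sum_square_blue] at h
    simp only at h
    rw [hhor _ _ (by omega) (by omega) (by omega), hout', add_zero, add_zero,
      add_sub_cancel_right] at h
    have ha' : (2 * ((a + 1 : ℕ) : ℤ)) = 2 * a + 1 + 1 := by push_cast; ring
    rw [ha']
    exact (CharTwo.add_eq_zero.1 h).symm

theorem green_eq_zero (hd : 2 ≤ d) (hout : ∀ v, v ∉ latticeVertices d → F v = 0)
    (hsq : ∀ i m, IsSquareCentre i m → m ∈ Set.Icc lowCorner (highCorner d) →
      ∑ v ∈ square i m, F v = 0)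
    (hpivot : ∀ p ∈ greenCentres d, F (p.1, p.2.1, p.2.2 - 1) = 0)
    (h₀ : F (0, 0, 2 * d - 1) = 0) (v : Point) : F v = 0 := by
  by_cases hv : v ∈ latticeVertices d
  · rw [mem_latticeVertices, isVertex_iff] at hv
    obtain ⟨x, y, z⟩ := v
    simp only at hv
    by_cases hz : z % 2 = 0
    · have := green_horizontal_eq_zero hd hout hsq hpivot (z / 2).toNat (by omega) x y hv.1.1
        hv.1.2.1 (by omega)
      rwa [show 2 * (((z / 2).toNat : ℕ) : ℤ) = z by omega] at this
    · by_cases hz' : z = 2 * d - 1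
      · have := green_top_eq hd hout hsq hpivot (x / 2).toNat (y / 2).toNat (by omega) (by omega)
        rw [h₀] at this
        rwa [show 2 * (((x / 2).toNat : ℕ) : ℤ) = x by omega,
          show 2 * (((y / 2).toNat : ℕ) : ℤ) = y by omega, ← hz'] at this
      · have := hpivot (x, y, z + 1) (by
          rw [mem_greenCentres hd, isCentre_green, mem_box_iff]
          simp only
          omega)
        rwa [add_sub_cancel_right] at this
  · exact hout v hv

end GreenKernel

/-- The qubit below the centre of a green cell. -/
def greenPivot (d : ℕ) (p : greenCentres d) : Qubit d :=
  ⟨(p.1.1, p.1.2.1, p.1.2.2 - 1), by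
    have := p.2
    simp only [greenCentres, Finset.mem_product, mem_steps] at this
    rw [mem_latticeVertices, isVertex_iff]
    simp only
    omega⟩

theorem canonicalZ_red_blue_inter_octahedron {d : ℕ} {p : Point} (hp : IsCentre .green p)
    (hp' : p ∈ Set.Icc lowCorner (highCorner d)) (s₁ s₂ : Bool) :
    Even (qubitsOn d (octahedron p) ∩ canonicalZ d .red .blue s₁ s₂).card := by
  rw [canonicalZ_red_blue, qubitsOn_inter]
  rw [isCentre_green] at hp
  rw [mem_box_iff] at hp'
  by_cases h : p.1 = side d .red s₁ ∧ p.2.1 = side d .blue s₂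
  · have : qubitsOn d (octahedron p ∩ ↑(({side d .red s₁} : Finset ℤ) ×ˢ
        ({side d .blue s₂} : Finset ℤ) ×ˢ steps 1 d)) =
        qubitsOn d ↑({(p.1, p.2.1, p.2.2 - 1), (p.1, p.2.1, p.2.2 + 1)} : Finset Point) := by
      refine qubitsOn_congr fun v _ => ?_
      simp only [Set.mem_inter_iff, mem_octahedron, Finset.mem_coe, Finset.mem_product,
        Finset.mem_singleton, mem_steps, Finset.mem_insert, Prod.ext_iff]
      omega
    rw [this, card_qubitsOn_coe, Finset.card_pair]
    · exact even_two
    · simp only [ne_eq, Prod.mk.injEq]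
      omega
    · intro v
      simp only [Finset.mem_insert, Finset.mem_singleton, Prod.ext_iff, mem_latticeVertices,
        isVertex_iff]
      omega
  · have : qubitsOn d (octahedron p ∩ ↑(({side d .red s₁} : Finset ℤ) ×ˢ
        ({side d .blue s₂} : Finset ℤ) ×ˢ steps 1 d)) = ∅ := by
      refine Finset.eq_empty_of_forall_notMem fun v hv => ?_
      rw [mem_qubitsOn] at hv
      simp only [Set.mem_inter_iff, mem_octahedron, Finset.mem_coe, Finset.mem_product,
        Finset.mem_singleton, mem_steps] at hv
      have h1 := side_red d s₁
      have h2 := side_blue d s₂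
      omega
    rw [this, Finset.card_empty]
    exact Even.zero

/-- The three boundaries of different colours meet in one qubit. -/
theorem card_canonicalX_inter_canonicalZ (d : ℕ) (hd : 2 ≤ d) (c c₁ c₂ : Colour) (h₁ : c ≠ c₁)
    (h₂ : c ≠ c₂) (h₁₂ : c₁ ≠ c₂) (s s₁ s₂ : Bool) :
    (canonicalX d c s ∩ canonicalZ d c₁ c₂ s₁ s₂).card = 1 := by
  have key : ∀ r b g : Bool,
      (boundary d .red r ∩ (boundary d .blue b ∩ boundary d .green g)).card = 1 := by
    intro r b g
    have h1 := side_red d r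
    have h2 := side_blue d b
    have h3 := side_green d g
    have : boundary d .red r ∩ (boundary d .blue b ∩ boundary d .green g) =
        qubitsOn d ↑({(side d .red r, side d .blue b, side d .green g)} : Finset Point) := by
      refine eq_qubitsOn_coe fun v => ?_
      simp only [Finset.mem_inter, mem_boundary, coord, Finset.mem_singleton, Prod.ext_iff]
    rw [this, card_qubitsOn_coe, Finset.card_singleton]
    rw [Finset.singleton_subset_iff, mem_latticeVertices, isVertex_iff]
    simp only
    omega
  unfold canonicalX canonicalZ
  cases c <;> cases c₁ <;> cases c₂ <;> first
    | exact absurd rfl h₁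
    | exact absurd rfl h₂
    | exact absurd rfl h₁₂
    | skip
  · rw [Finset.inter_comm (boundary d .green s₁)]
    exact key s s₂ s₁
  · exact key s s₁ s₂
  · rw [Finset.inter_comm, Finset.inter_assoc]
    exact key s₁ s₂ s
  · rw [Finset.inter_comm, Finset.inter_comm (boundary d .blue s₁), Finset.inter_assoc]
    exact key s₂ s₁ s
  · rw [Finset.inter_left_comm]
    exact key s₁ s s₂
  · rw [Finset.inter_comm (boundary d .green s₁), Finset.inter_left_comm]
    exact key s₂ s s₁

theorem isPivotedCode_green (d : ℕ) (hd : 2 ≤ d) :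
    IsPivotedCode (xSupports d .green) (zSupports d .green)
      (fun p : greenCentres d => qubitsOn d (octahedron p.1)) (greenPivot d) (fun v => v.1.2.2)
      (canonicalX d .green false) (canonicalZ d .red .blue false false)
      ⟨(0, 0, 2 * d - 1), by rw [mem_latticeVertices, isVertex_iff]; simp only; omega⟩ where
  range_eq := by
    ext s
    constructor
    · rintro ⟨p, rfl⟩
      obtain ⟨hp, hp'⟩ := (mem_greenCentres hd).1 p.2
      exact ⟨p.1, hp, hp', rfl⟩
    · rintro ⟨p, hp, hp', rfl⟩
      exact ⟨⟨p, (mem_greenCentres hd).2 ⟨hp, hp'⟩⟩, rfl⟩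
  pivot_mem p := by
    rw [mem_qubitsOn, mem_octahedron]
    simp [greenPivot]
  rank_lt p q hpq h := by
    have hp := p.2
    have hq := q.2
    rw [mem_greenCentres hd, isCentre_green] at hp hq
    rw [mem_qubitsOn, mem_octahedron] at h
    rw [Ne, Subtype.ext_iff, Prod.ext_iff, Prod.ext_iff] at hpq
    simp only [greenPivot] at h ⊢
    omega
  even_inter := by
    rw [zSupports_green d hd]
    rintro _ ⟨p, hp, hp', rfl⟩ _ ⟨i, m, hm, hm', rfl⟩
    exact even_card_qubitsOn_inter.2 (sum_square_octahedron hp hp' hm hm')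
  even_x₀ := by
    rw [zSupports_green d hd]
    rintro _ ⟨i, m, hm, hm', rfl⟩
    exact even_card_qubitsOn_inter.2 (sum_square_side hm hm')
  even_z₀ := by
    rintro _ ⟨p, hp, hp', rfl⟩
    exact canonicalZ_red_blue_inter_octahedron hp hp' _ _
  odd_x₀_z₀ := by
    rw [card_canonicalX_inter_canonicalZ d hd] <;> simp
  eq_zero f hf hpivot h₀ := by
    funext v
    rw [← extend_coe f v]
    refine green_eq_zero hd (fun v => extend_of_notMem f) (fun i m hm hm' => ?_)
      (fun p hp => ?_) ?_ v.1
    · rw [← sum_qubitsOn]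
      refine hf _ ?_
      rw [zSupports_green d hd]
      exact ⟨i, m, hm, hm', rfl⟩
    · exact (extend_coe f (greenPivot d ⟨p, hp⟩)).trans (hpivot ⟨p, hp⟩)
    · exact (extend_coe f ⟨_, _⟩).trans h₀

theorem isLogicalPair_green (d : ℕ) (hd : 2 ≤ d) (c₁ c₂ : Colour) (h₁ : .green ≠ c₁)
    (h₂ : .green ≠ c₂) (h₁₂ : c₁ ≠ c₂) (s s₁ s₂ : Bool) :
    IsLogicalPair (stabilizerGroup d .green) (xOp (canonicalX d .green s))
      (zOp (canonicalZ d c₁ c₂ s₁ s₂)) := by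
  refine isLogicalPair_closure ?_ ?_ ?_
  · rw [zSupports_green d hd]
    rintro _ ⟨i, m, hm, hm', rfl⟩
    exact even_card_qubitsOn_inter.2 (sum_square_side hm hm')
  · rintro _ ⟨p, hp, hp', rfl⟩
    cases c₁ <;> cases c₂ <;> first
      | exact absurd rfl h₁
      | exact absurd rfl h₂
      | exact absurd rfl h₁₂
      | skip
    · exact canonicalZ_red_blue_inter_octahedron hp hp' _ _
    · rw [canonicalZ_comm]
      exact canonicalZ_red_blue_inter_octahedron hp hp' _ _
  · rw [card_canonicalX_inter_canonicalZ d hd _ _ _ h₁ h₂ h₁₂]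
    exact odd_one

/-! ## Adapted coordinates for the red and blue codes -/

/-- Exchanges red and blue. -/
def other : Colour → Colour
  | .red => .blue
  | .green => .green
  | .blue => .red

/-- The point with coordinate `a` of colour `c`, coordinate `b` of the colour opposite to `c`, and
last coordinate `z`, where `c` is red or blue. -/
def pt (c : Colour) (a b z : ℤ) : Point :=
  match c with
  | .blue => (b, a, z)
  | _ => (a, b, z)

/-- The residue modulo `4` of the coordinate sum of the centre of a `c`-cell. -/
def residue : Colour → ℤ
  | .blue => 1
  | _ => 3

theorem residue_eq (c : Colour) : residue c = 1 ∨ residue c = 3 := by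
  cases c <;> simp [residue]

theorem other_ne_green {c : Colour} (hc : c ≠ .green) : other c ≠ .green := by
  cases c <;> simp_all [other]

theorem exists_eq_pt (c : Colour) (v : Point) : ∃ a b z, v = pt c a b z := by
  cases c
  · exact ⟨v.1, v.2.1, v.2.2, rfl⟩
  · exact ⟨v.1, v.2.1, v.2.2, rfl⟩
  · exact ⟨v.2.1, v.1, v.2.2, rfl⟩

theorem pt_inj {c : Colour} {a b z a' b' z' : ℤ} :
    pt c a b z = pt c a' b' z' ↔ a = a' ∧ b = b' ∧ z = z' := by
  cases c <;> simp only [pt, Prod.mk.injEq]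
  all_goals tauto

theorem pt_sum (c : Colour) (a b z : ℤ) : (pt c a b z).1 + (pt c a b z).2.1 = a + b := by
  cases c <;> simp only [pt]
  all_goals omega

theorem coord_pt {c : Colour} (hc : c ≠ .green) (a b z : ℤ) : coord c (pt c a b z) = a := by
  cases c <;> first | rfl | exact absurd rfl hc

theorem coord_other_pt {c : Colour} (hc : c ≠ .green) (a b z : ℤ) :
    coord (other c) (pt c a b z) = b := by
  cases c <;> first | rfl | exact absurd rfl hc

theorem coord_green_pt (c : Colour) (a b z : ℤ) : coord .green (pt c a b z) = z := by
  cases c <;> rfl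

theorem side_eq {d : ℕ} {c : Colour} (hc : c ≠ .green) (s : Bool) :
    side d c s = 0 ∨ side d c s = 2 * d - 2 := by
  cases c
  · exact side_red d s
  · exact absurd rfl hc
  · exact side_blue d s

theorem side_low {d : ℕ} {c : Colour} (hc : c ≠ .green) : side d c false = 0 := by
  cases c <;> first | rfl | exact absurd rfl hc

theorem side_high {d : ℕ} {c : Colour} (hc : c ≠ .green) : side d c true = 2 * d - 2 := by
  cases c <;> first | rfl | exact absurd rfl hc

theorem pt_mem_box {d : ℕ} {c : Colour} {a b z : ℤ} :
    pt c a b z ∈ Set.Icc lowCorner (highCorner d) ↔ (0 ≤ a ∧ a ≤ 2 * d - 2) ∧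
      (0 ≤ b ∧ b ≤ 2 * d - 2) ∧ (1 ≤ z ∧ z ≤ 2 * d - 1) := by
  rw [mem_box_iff]
  cases c <;> simp only [pt]
  all_goals tauto

theorem pt_mem_latticeVertices {d : ℕ} {c : Colour} {a b z : ℤ} :
    pt c a b z ∈ latticeVertices d ↔ ((0 ≤ a ∧ a ≤ 2 * d - 2) ∧
      (0 ≤ b ∧ b ≤ 2 * d - 2) ∧ (1 ≤ z ∧ z ≤ 2 * d - 1)) ∧
      ((a % 2 = 1 ∧ b % 2 = 0 ∧ z % 2 = 0) ∨ (a % 2 = 0 ∧ b % 2 = 1 ∧ z % 2 = 0) ∨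
        (a % 2 = 0 ∧ b % 2 = 0 ∧ z % 2 = 1)) := by
  rw [mem_latticeVertices, isVertex_iff]
  cases c <;> simp only [pt]
  all_goals tauto

theorem pt_mem_cuboctahedron {c : Colour} {a b z a' b' z' : ℤ} :
    pt c a b z ∈ cuboctahedron (pt c a' b' z') ↔
      (a = a' ∧ (b = b' - 1 ∨ b = b' + 1) ∧ (z = z' - 1 ∨ z = z' + 1)) ∨
      ((a = a' - 1 ∨ a = a' + 1) ∧ b = b' ∧ (z = z' - 1 ∨ z = z' + 1)) ∨
      ((a = a' - 1 ∨ a = a' + 1) ∧ (b = b' - 1 ∨ b = b' + 1) ∧ z = z') := by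
  rw [mem_cuboctahedron]
  cases c <;> simp only [pt]
  all_goals tauto

theorem isCentre_pt {c : Colour} (hc : c ≠ .green) {a b z : ℤ} : IsCentre c (pt c a b z) ↔
    a % 2 = 1 ∧ b % 2 = 1 ∧ z % 2 = 1 ∧ (a + b + z) % 4 = residue c := by
  cases c
  · exact isCentre_red
  · exact absurd rfl hc
  · rw [isCentre_blue, add_comm a b]
    simp only [pt, residue]
    tauto

theorem isCentre_other_pt {c : Colour} (hc : c ≠ .green) {a b z : ℤ} :
    IsCentre (other c) (pt c a b z) ↔
      a % 2 = 1 ∧ b % 2 = 1 ∧ z % 2 = 1 ∧ (a + b + z) % 4 = 4 - residue c := by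
  cases c
  · exact isCentre_blue
  · exact absurd rfl hc
  · rw [other, isCentre_red, add_comm a b]
    simp only [pt, residue]
    norm_num
    tauto

theorem isCentre_green_pt {c : Colour} {a b z : ℤ} :
    IsCentre .green (pt c a b z) ↔ a % 2 = 0 ∧ b % 2 = 0 ∧ z % 2 = 0 := by
  rw [isCentre_green]
  cases c <;> simp only [pt]
  all_goals tauto

theorem isCorner_pt {c : Colour} {a b z a' b' z' : ℤ} :
    IsCorner (pt c a b z) (pt c a' b' z') ↔ (a' = a - 1 ∨ a' = a + 1) ∧
      (b' = b - 1 ∨ b' = b + 1) ∧ (z' = z - 1 ∨ z' = z + 1) := by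
  unfold IsCorner
  cases c <;> simp only [pt]
  all_goals tauto

theorem triangle_pt (c : Colour) (a b z a' b' z' : ℤ) :
    triangle (pt c a b z) (pt c a' b' z') = {pt c a' b z, pt c a b' z, pt c a b z'} := by
  cases c
  · rfl
  · rfl
  · exact Finset.insert_comm _ _ _

theorem zSupports_of_ne_green {d : ℕ} {c : Colour} (hc : c ≠ .green) : zSupports d c =
    faces d (other c) .green ∪ boundaryEdges d c (other c) .green := by
  cases c <;> first | rfl | exact absurd rfl hc

theorem xSupports_of_ne_green {d : ℕ} {c : Colour} (hc : c ≠ .green) : xSupports d c =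
    cells d c ∪ boundaryFaces d (other c) := by
  cases c <;> first | rfl | exact absurd rfl hc

theorem subset_latticeVertices_of_card_le {d : ℕ} {t : Finset Point}
    (h : t.card ≤ (qubitsOn d ↑t).card) : t ⊆ latticeVertices d := by
  classical
  have hcard : (qubitsOn d ↑t).card = (t.filter (· ∈ latticeVertices d)).card := by
    rw [← card_qubitsOn_coe (t := t.filter (· ∈ latticeVertices d))
      (fun v hv => (Finset.mem_filter.1 hv).2)]
    refine congrArg _ (qubitsOn_congr fun v hv => ?_)
    simp [hv]
  rw [hcard] at h
  exact Finset.filter_eq_self.1 (Finset.eq_of_subset_of_card_le (Finset.filter_subset _ _) h)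

theorem card_triangle_pt {c : Colour} {a b z a' b' z' : ℤ} (ha : a' ≠ a) (hb : b' ≠ b) : (triangle (pt c a b z) (pt c a' b' z')).card = 3 := by
  rw [triangle_pt, Finset.card_eq_three]
  refine ⟨_, _, _, ?_, ?_, ?_, rfl⟩ <;> rw [Ne, pt_inj] <;> tauto

theorem sum_triangle_pt {c : Colour} {a b z a' b' z' : ℤ} (ha : a' ≠ a) (hb : b' ≠ b)
    (f : Point → ZMod 2) : ∑ v ∈ triangle (pt c a b z) (pt c a' b' z'), f v =
      f (pt c a' b z) + (f (pt c a b' z) + f (pt c a b z')) := by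
  rw [triangle_pt, Finset.sum_insert, Finset.sum_insert, Finset.sum_singleton] <;>
    simp only [Finset.mem_insert, Finset.mem_singleton, pt_inj] <;> tauto

/-! ## The stabilizers of the red and blue codes -/

/-- The corner of the cell around `(a', b', z')`, of the colour opposite to the one with residue
`κ`, at the centre `(a, b, z)` of a green cell supports a `Z` stabilizer. -/
def IsZCorner (d : ℕ) (κ a b z a' b' z' : ℤ) : Prop :=
  (a % 2 = 0 ∧ b % 2 = 0 ∧ z % 2 = 0) ∧ ((0 ≤ a ∧ a ≤ 2 * d - 2) ∧ (0 ≤ b ∧ b ≤ 2 * d - 2) ∧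
    (2 ≤ z ∧ z ≤ 2 * d - 2) ∧ 0 ≤ b' ∧ b' ≤ 2 * d - 2) ∧
  ((a' = a - 1 ∨ a' = a + 1) ∧ (b' = b - 1 ∨ b' = b + 1) ∧ (z' = z - 1 ∨ z' = z + 1)) ∧
  (a' + b' + z') % 4 = 4 - κ

theorem faces_subset {d : ℕ} {c : Colour} (hc : c ≠ .green) {s : Finset (Qubit d)}
    (hs : s ∈ faces d (other c) .green) : ∃ a b z a' b' z',
      IsZCorner d (residue c) a b z a' b' z' ∧
        s = qubitsOn d ↑(triangle (pt c a b z) (pt c a' b' z')) := by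
  obtain ⟨f, hf, rfl, hcard⟩ := hs
  obtain ⟨p, q, hp, hq, hpq, rfl⟩ := (isFace_green_iff (other_ne_green hc)).1 hf
  obtain ⟨a, b, z, rfl⟩ := exists_eq_pt c p
  obtain ⟨a', b', z', rfl⟩ := exists_eq_pt c q
  refine ⟨a, b, z, a', b', z', ?_, rfl⟩
  have hcard3 : (triangle (pt c a b z) (pt c a' b' z')).card ≤ 3 := Finset.card_le_three
  have hsub := subset_latticeVertices_of_card_le (hcard3.trans hcard)
  rw [triangle_pt] at hsub
  have h1 : pt c a' b z ∈ latticeVertices d := hsub (by simp)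
  have h2 : pt c a b' z ∈ latticeVertices d := hsub (by simp)
  rw [pt_mem_latticeVertices] at h1 h2
  replace h1 := h1.1
  replace h2 := h2.1
  rw [isCentre_green_pt] at hp
  rw [isCentre_other_pt hc] at hq
  rw [isCorner_pt] at hpq
  exact ⟨hp, by omega, hpq, hq.2.2.2⟩

theorem boundaryEdges_subset {d : ℕ} {c : Colour} (hc : c ≠ .green)
    {s : Finset (Qubit d)} (hs : s ∈ boundaryEdges d c (other c) .green) : ∃ a b z a' b' z',
      IsZCorner d (residue c) a b z a' b' z' ∧
        s = qubitsOn d ↑(triangle (pt c a b z) (pt c a' b' z')) := by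
  obtain ⟨t, ⟨_, ⟨r, hr, hrbox, rfl⟩, high, rfl, -⟩, u, hu, v, hv, huv, rfl, f, hf, huf, hvf⟩ := hs
  obtain ⟨p, q, hp, hq, hpq, rfl⟩ := (isFace_green_iff (other_ne_green hc)).1 hf
  obtain ⟨a, b, z, rfl⟩ := exists_eq_pt c p
  obtain ⟨a', b', z', rfl⟩ := exists_eq_pt c q
  obtain ⟨ra, rb, rz, rfl⟩ := exists_eq_pt c r
  rw [Finset.mem_inter, mem_qubitsOn, mem_boundary, cell_of_ne_green hc] at hu hv
  rw [isCentre_green_pt] at hp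
  rw [isCentre_other_pt hc] at hq
  rw [isCentre_pt hc] at hr
  rw [isCorner_pt] at hpq
  rw [pt_mem_box] at hrbox
  have hside := side_eq (d := d) hc high
  generalize side d c high = σ at *
  have hcases : ∀ w : Qubit d, coord c w.1 = σ →
      w.1 ∈ (triangle (pt c a b z) (pt c a' b' z') : Set Point) →
      w.1 = pt c a b' z ∨ w.1 = pt c a b z' := by
    intro w hw hwt
    rw [Finset.mem_coe, triangle_pt, Finset.mem_insert, Finset.mem_insert,
      Finset.mem_singleton] at hwt
    refine hwt.resolve_left fun h => ?_
    rw [h, coord_pt hc] at hw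
    omega
  have key : ∀ u v : Qubit d, u.1 ∈ cuboctahedron (pt c ra rb rz) →
      v.1 ∈ cuboctahedron (pt c ra rb rz) → coord c u.1 = σ → u.1 = pt c a b' z →
      v.1 = pt c a b z' → IsZCorner d (residue c) a b z a' b' z' ∧
        ({u, v} : Finset (Qubit d)) =
          qubitsOn d ↑(triangle (pt c a b z) (pt c a' b' z')) := by
    intro u v hu hv hσ hu' hv'
    have hul := u.2
    have hvl := v.2
    rw [hu', pt_mem_latticeVertices] at hul
    rw [hv', pt_mem_latticeVertices] at hvl
    rw [hu', pt_mem_cuboctahedron] at hu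
    rw [hv', pt_mem_cuboctahedron] at hv
    rw [hu', coord_pt hc] at hσ
    replace hul := hul.1
    replace hvl := hvl.1
    have hb' : b' = rb := by omega
    have hz' : z' = rz := by omega
    have ha' : a' ≠ ra := by
      rintro rfl
      rw [← hb', ← hz'] at hr
      have := residue_eq c
      omega
    have hra : ra = a - 1 ∨ ra = a + 1 := by omega
    have hout : ¬ (0 ≤ a' ∧ a' ≤ 2 * (d : ℤ) - 2) := by
      clear hu hv
      omega
    refine ⟨⟨hp, by clear hu hv; omega, hpq, hq.2.2.2⟩, eq_qubitsOn_coe fun w => ?_⟩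
    rw [triangle_pt, Finset.mem_insert, Finset.mem_insert, Finset.mem_insert,
      Finset.mem_singleton, Finset.mem_singleton, Subtype.ext_iff, Subtype.ext_iff, hu', hv']
    refine ⟨Or.inr, fun h => h.resolve_left fun h => ?_⟩
    have := w.2
    rw [h, pt_mem_latticeVertices] at this
    exact hout this.1.1
  refine ⟨a, b, z, a', b', z', ?_⟩
  rcases hcases u hu.2 huf with hu' | hu' <;> rcases hcases v hv.2 hvf with hv' | hv'
  · exact absurd (Subtype.ext (hu'.trans hv'.symm)) huv
  · exact key u v hu.1 hv.1 hu.2 hu' hv'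
  · rw [Finset.pair_comm]
    exact key v u hv.1 hu.1 hv.2 hv' hu'
  · exact absurd (Subtype.ext (hu'.trans hv'.symm)) huv

theorem zSupports_eq {d : ℕ} {c : Colour} (hc : c ≠ .green) :
    zSupports d c = {s | ∃ a b z a' b' z', IsZCorner d (residue c) a b z a' b' z' ∧
      s = qubitsOn d ↑(triangle (pt c a b z) (pt c a' b' z'))} := by
  rw [zSupports_of_ne_green hc]
  refine Set.Subset.antisymm (fun s hs => ?_) ?_
  · exact hs.elim (faces_subset hc) (boundaryEdges_subset hc)
  rintro _ ⟨a, b, z, a', b', z', ⟨hp, hbox, hpq, hres⟩, rfl⟩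
  have hκ := residue_eq c
  have hface : IsFace (other c) .green ↑(triangle (pt c a b z) (pt c a' b' z')) := by
    refine (isFace_green_iff (other_ne_green hc)).2 ⟨_, _, isCentre_green_pt.2 hp,
      (isCentre_other_pt hc).2 ⟨?_, ?_, ?_, hres⟩, isCorner_pt.2 hpq, rfl⟩ <;> omega
  by_cases ha' : 0 ≤ a' ∧ a' ≤ 2 * (d : ℤ) - 2
  · refine Or.inl ⟨_, hface, rfl, ?_⟩
    rw [card_qubitsOn_coe, card_triangle_pt] <;> try omega
    rw [triangle_pt]
    intro v
    simp only [Finset.mem_insert, Finset.mem_singleton]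
    rintro (rfl | rfl | rfl) <;> rw [pt_mem_latticeVertices] <;> omega
  · obtain ⟨high, ra, hside, hra, hra'⟩ : ∃ (high : Bool) (ra : ℤ), side d c high = a ∧
        (ra = a - 1 ∨ ra = a + 1) ∧ ra + a' = 2 * a := by
      by_cases h : a = 0
      · exact ⟨false, 1, by rw [side_low hc, h], by omega, by omega⟩
      · exact ⟨true, 2 * d - 3, by rw [side_high hc]; omega, by omega, by omega⟩
    have hu : pt c a b' z ∈ latticeVertices d := by
      rw [pt_mem_latticeVertices]
      omega
    have hv : pt c a b z' ∈ latticeVertices d := by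
      rw [pt_mem_latticeVertices]
      omega
    have hw : pt c a (2 * b' - b) z' ∈ latticeVertices d := by
      rw [pt_mem_latticeVertices]
      omega
    have hmem : ∀ v, v ∈ ({pt c a b' z, pt c a b z', pt c a (2 * b' - b) z'} : Set Point) →
        v ∈ cuboctahedron (pt c ra b' z') ∩ {v | coord c v = side d c high} := by
      rintro v (rfl | rfl | rfl) <;>
        rw [Set.mem_inter_iff, pt_mem_cuboctahedron, Set.mem_ofPred_eq, coord_pt hc] <;> omega
    refine Or.inr ⟨qubitsOn d (cuboctahedron (pt c ra b' z') ∩ {v | coord c v = side d c high}),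
      ⟨qubitsOn d (cuboctahedron (pt c ra b' z')), ⟨pt c ra b' z', ?_, ?_, ?_⟩, high, ?_, ?_⟩,
      ⟨_, hu⟩, ?_, ⟨_, hv⟩, ?_, ?_, ?_, _, hface, ?_, ?_⟩
    · rw [isCentre_pt hc]
      omega
    · rw [pt_mem_box]
      omega
    · rw [cell_of_ne_green hc]
    · rw [boundary_eq, qubitsOn_inter]
    · rw [three_le_card_qubitsOn_iff]
      refine ⟨_, hu, _, hv, _, hw, hmem _ (by simp), hmem _ (by simp), hmem _ (by simp), ?_⟩
      simp only [ne_eq, pt_inj]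
      omega
    · exact mem_qubitsOn.2 (hmem _ (by simp))
    · exact mem_qubitsOn.2 (hmem _ (by simp))
    · rw [Ne, Subtype.mk.injEq, pt_inj]
      omega
    · symm
      refine eq_qubitsOn_coe fun w => ?_
      rw [triangle_pt, Finset.mem_insert, Finset.mem_insert, Finset.mem_insert,
        Finset.mem_singleton, Finset.mem_singleton, Subtype.ext_iff, Subtype.ext_iff]
      refine ⟨Or.inr, fun h => h.resolve_left fun h => ?_⟩
      have := w.2
      rw [h, pt_mem_latticeVertices] at this
      exact ha' this.1.1
    · rw [triangle_pt]
      simp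
    · rw [triangle_pt]
      simp

/-- The centres, in adapted coordinates, of the cuboctahedra which support, cut to the box, the `X`
stabilizers of the red (`κ = 3`) or blue (`κ = 1`) code. Those with second coordinate `-1` or
`2d - 1` lie outside of the box and leave a face on the boundary. -/
def cuboctahedronCentres (d : ℕ) (κ : ℤ) : Finset (ℤ × ℤ × ℤ) :=
  (steps 1 (d - 1) ×ˢ steps (-1) (d + 1) ×ˢ steps 1 d).filter
    fun t => (t.1 + t.2.1 + t.2.2) % 4 = κ

theorem mem_cuboctahedronCentres {d : ℕ} (hd : 2 ≤ d) {κ : ℤ} {t : ℤ × ℤ × ℤ} :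
    t ∈ cuboctahedronCentres d κ ↔ (t.1 % 2 = 1 ∧ t.2.1 % 2 = 1 ∧ t.2.2 % 2 = 1 ∧
      (t.1 + t.2.1 + t.2.2) % 4 = κ) ∧ (1 ≤ t.1 ∧ t.1 ≤ 2 * d - 3) ∧
      (-1 ≤ t.2.1 ∧ t.2.1 ≤ 2 * d - 1) ∧ (1 ≤ t.2.2 ∧ t.2.2 ≤ 2 * d - 1) := by
  simp only [cuboctahedronCentres, Finset.mem_filter, Finset.mem_product, mem_steps]
  constructor
  · rintro ⟨⟨h1, h2, h3⟩, h4⟩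
    exact ⟨⟨by omega, by omega, by omega, h4⟩, by omega, by omega, by omega⟩
  · rintro ⟨⟨h1, h2, h3, h4⟩, h5, h6, h7⟩
    exact ⟨⟨by omega, by omega, by omega⟩, h4⟩

theorem card_cuboctahedronCentres_eq (d : ℕ) (hd : 2 ≤ d) :
    (cuboctahedronCentres d 1).card = (cuboctahedronCentres d 3).card := by
  by_cases h : d % 2 = 0
  · refine Finset.card_nbij' (fun t => (t.1, t.2.1, 2 * d - t.2.2))
      (fun t => (t.1, t.2.1, 2 * d - t.2.2)) ?_ ?_ ?_ ?_
    · intro t ht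
      rw [Finset.mem_coe, mem_cuboctahedronCentres hd] at *
      simp only
      omega
    · intro t ht
      rw [Finset.mem_coe, mem_cuboctahedronCentres hd] at *
      simp only
      omega
    · intro t _
      simp
    · intro t _
      simp
  · refine Finset.card_nbij' (fun t => (t.1, 2 * d - 2 - t.2.1, t.2.2))
      (fun t => (t.1, 2 * d - 2 - t.2.1, t.2.2)) ?_ ?_ ?_ ?_
    · intro t ht
      rw [Finset.mem_coe, mem_cuboctahedronCentres hd] at *
      simp only
      omega
    · intro t ht
      rw [Finset.mem_coe, mem_cuboctahedronCentres hd] at *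
      simp only
      omega
    · intro t _
      simp
    · intro t _
      simp

theorem card_cuboctahedronCentres (d : ℕ) (hd : 2 ≤ d) {κ : ℤ} (hκ : κ = 1 ∨ κ = 3) :
    (Fintype.card (cuboctahedronCentres d κ) : ℚ) =
      ((d : ℚ) - 1) / 2 * ((d : ℚ) ^ 2 + (d : ℚ)) := by
  have hsum : (cuboctahedronCentres d 1).card + (cuboctahedronCentres d 3).card =
      (d - 1) * ((d + 1) * d) := by
    rw [← Finset.card_union_of_disjoint]
    · have : cuboctahedronCentres d 1 ∪ cuboctahedronCentres d 3 =
          steps 1 (d - 1) ×ˢ steps (-1) (d + 1) ×ˢ steps 1 d := by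
        rw [cuboctahedronCentres, cuboctahedronCentres, ← Finset.filter_or,
          Finset.filter_eq_self]
        intro t ht
        simp only [Finset.mem_product, mem_steps] at ht
        omega
      rw [this]
      simp only [Finset.card_product, card_steps]
    · refine Finset.disjoint_filter.2 fun t _ h1 h3 => ?_
      omega
  have heq := card_cuboctahedronCentres_eq d hd
  have h1 : (2 * (cuboctahedronCentres d κ).card : ℚ) = (d - 1) * ((d + 1) * d) := by
    have h2 : 2 * (cuboctahedronCentres d κ).card = (d - 1) * ((d + 1) * d) := by
      rcases hκ with rfl | rfl <;> omega
    have h3 : ((d - 1 : ℕ) : ℚ) = d - 1 := by push_cast [Nat.cast_sub (show 1 ≤ d by omega)]; ring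
    rw [← h3]
    exact_mod_cast h2
  rw [Fintype.card_coe]
  linear_combination h1 / 2

theorem xSupports_eq {d : ℕ} (hd : 2 ≤ d) {c : Colour} (hc : c ≠ .green) :
    xSupports d c = {s | ∃ t ∈ cuboctahedronCentres d (residue c),
      s = qubitsOn d (cuboctahedron (pt c t.1 t.2.1 t.2.2))} := by
  have hκ := residue_eq c
  rw [xSupports_of_ne_green hc]
  have hface : ∀ (high : Bool) (a b b' z : ℤ), (b' = b - 2 ∧ b = 1 ∧ high = false ∨
      b' = b + 2 ∧ b = 2 * d - 3 ∧ high = true) →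
      qubitsOn d (cell (other c) (pt c a b z)) ∩ boundary d (other c) high =
        qubitsOn d (cuboctahedron (pt c a b' z)) := by
    intro high a b b' z h
    have hside : side d (other c) high = if high then 2 * (d : ℤ) - 2 else 0 := by
      cases high
      · exact side_low (other_ne_green hc)
      · exact side_high (other_ne_green hc)
    rw [cell_of_ne_green (other_ne_green hc), boundary_eq, qubitsOn_inter, hside]
    refine qubitsOn_congr fun v hv => ?_
    obtain ⟨va, vb, vz, rfl⟩ := exists_eq_pt c v
    rw [pt_mem_latticeVertices] at hv
    replace hv := hv.1.2.1
    rw [Set.mem_inter_iff, pt_mem_cuboctahedron, pt_mem_cuboctahedron, Set.mem_ofPred_eq,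
      coord_other_pt hc]
    rcases h with ⟨rfl, rfl, rfl⟩ | ⟨rfl, rfl, rfl⟩
    · simp only [Bool.false_eq_true, if_false]
      omega
    · simp only [if_true]
      omega
  apply Set.Subset.antisymm
  · rintro s (⟨p, hp, hbox, rfl⟩ | ⟨t, ⟨p, hp, hbox, rfl⟩, high, rfl, hcard⟩)
    · obtain ⟨a, b, z, rfl⟩ := exists_eq_pt c p
      rw [isCentre_pt hc] at hp
      rw [pt_mem_box] at hbox
      refine ⟨(a, b, z), ?_, by rw [cell_of_ne_green hc]⟩
      rw [mem_cuboctahedronCentres hd]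
      simp only
      omega
    · obtain ⟨a, b, z, rfl⟩ := exists_eq_pt c p
      rw [isCentre_other_pt hc] at hp
      rw [pt_mem_box] at hbox
      have hb : b = 1 ∧ high = false ∨ b = 2 * d - 3 ∧ high = true := by
        obtain ⟨v, hv⟩ := Finset.card_pos.1 (lt_of_lt_of_le (by norm_num) hcard)
        rw [Finset.mem_inter, mem_qubitsOn, mem_boundary,
          cell_of_ne_green (other_ne_green hc)] at hv
        obtain ⟨va, vb, vz, hv'⟩ := exists_eq_pt c v.1
        rw [hv', coord_other_pt hc, pt_mem_cuboctahedron] at hv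
        cases high
        · rw [side_low (other_ne_green hc)] at hv
          exact Or.inl ⟨by omega, rfl⟩
        · rw [side_high (other_ne_green hc)] at hv
          exact Or.inr ⟨by omega, rfl⟩
      rcases hb with ⟨rfl, rfl⟩ | ⟨rfl, rfl⟩
      · refine ⟨(a, -1, z), ?_, hface _ _ _ _ _ (Or.inl ⟨rfl, rfl, rfl⟩)⟩
        rw [mem_cuboctahedronCentres hd]
        simp only
        omega
      · refine ⟨(a, 2 * d - 1, z), ?_, hface _ _ _ (2 * d - 1) _ (Or.inr ⟨by omega, rfl, rfl⟩)⟩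
        rw [mem_cuboctahedronCentres hd]
        simp only
        omega
  · rintro _ ⟨⟨a, b, z⟩, ht, rfl⟩
    rw [mem_cuboctahedronCentres hd] at ht
    simp only at ht ⊢
    by_cases hb : 0 ≤ b ∧ b ≤ 2 * d - 2
    · refine Or.inl ⟨pt c a b z, ?_, ?_, by rw [cell_of_ne_green hc]⟩
      · rw [isCentre_pt hc]
        exact ht.1
      · rw [pt_mem_box]
        omega
    · obtain ⟨high, b', hb'⟩ : ∃ (high : Bool) (b' : ℤ), b = b' - 2 ∧ b' = 1 ∧ high = false ∨
          b = b' + 2 ∧ b' = 2 * d - 3 ∧ high = true := by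
        by_cases h : b = -1
        · exact ⟨false, 1, Or.inl ⟨by omega, rfl, rfl⟩⟩
        · exact ⟨true, 2 * d - 3, Or.inr ⟨by omega, rfl, rfl⟩⟩
      have hf := hface high a b' b z hb'
      have hb'' : (b = b' - 2 ∧ b' = 1) ∨ (b = b' + 2 ∧ b' = 2 * d - 3) := by tauto
      clear hb'
      refine Or.inr ⟨_, ⟨pt c a b' z, ?_, ?_, rfl⟩, high, hf.symm, ?_⟩
      · rw [isCentre_other_pt hc]
        omega
      · rw [pt_mem_box]
        omega
      · obtain ⟨β, hβ, hβ'⟩ : ∃ β : ℤ, (β = b - 1 ∨ β = b + 1) ∧ (β = 0 ∨ β = 2 * d - 2) := by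
          rcases hb'' with h | h
          · exact ⟨0, by omega, by omega⟩
          · exact ⟨2 * d - 2, by omega, by omega⟩
        obtain ⟨ζ, hζ, hζ'⟩ : ∃ ζ : ℤ, (ζ = z - 1 ∨ ζ = z + 1) ∧ 2 ≤ ζ ∧ ζ ≤ 2 * d - 2 := by
          by_cases h : z = 1
          · exact ⟨2, by omega, by omega⟩
          · exact ⟨z - 1, by omega, by omega⟩
        rw [three_le_card_qubitsOn_iff]
        refine ⟨pt c (a - 1) β z, ?_, pt c (a + 1) β z, ?_, pt c a β ζ, ?_, ?_⟩
        · rw [pt_mem_latticeVertices]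
          omega
        · rw [pt_mem_latticeVertices]
          omega
        · rw [pt_mem_latticeVertices]
          omega
        · refine ⟨?_, ?_, ?_, ?_⟩
          · rw [pt_mem_cuboctahedron]
            omega
          · rw [pt_mem_cuboctahedron]
            omega
          · rw [pt_mem_cuboctahedron]
            omega
          · simp only [ne_eq, pt_inj]
            omega

/-! ## Propagation of zeros in the red and blue codes -/

section Kernel

variable {d : ℕ} {κ : ℤ} {G : ℤ → ℤ → ℤ → ZMod 2}

theorem row_zero_step (hκ : κ = 1 ∨ κ = 3)
    (htri : ∀ a b z a' b' z', IsZCorner d κ a b z a' b' z' →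
      G a' b z + (G a b' z + G a b z') = 0)
    (hd : 2 ≤ d) (a z : ℤ) (ha : a % 2 = 0 ∧ 0 ≤ a ∧ a ≤ 2 * d - 2)
    (hz : z % 2 = 0 ∧ 2 ≤ z ∧ z ≤ 2 * d - 2)
    (hprev : G (a - 1) 0 z = 0) (hm : G a 0 (z - 1) = 0) (hp : G a 0 (z + 1) = 0) :
    G (a + 1) 0 z = 0 ∧ G a 1 z = 0 := by
  obtain ⟨z', z'', hz', hz'', hmod, hmod'⟩ : ∃ z' z'', (z' = z - 1 ∨ z' = z + 1) ∧
      (z'' = z - 1 ∨ z'' = z + 1) ∧ (a - 1 + 1 + z') % 4 = 4 - κ ∧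
      (a + 1 + 1 + z'') % 4 = 4 - κ := by
    by_cases h : (a - 1 + 1 + (z - 1)) % 4 = 4 - κ
    · exact ⟨z - 1, z + 1, by omega, by omega, by omega, by omega⟩
    · exact ⟨z + 1, z - 1, by omega, by omega, by omega, by omega⟩
  have h1 := htri a 0 z (a - 1) 1 z' (by unfold IsZCorner; omega)
  have h2 := htri a 0 z (a + 1) 1 z'' (by unfold IsZCorner; omega)
  have e1 : G a 0 z' = 0 := by rcases hz' with rfl | rfl <;> assumption
  have e2 : G a 0 z'' = 0 := by rcases hz'' with rfl | rfl <;> assumption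
  rw [hprev, e1, add_zero, zero_add] at h1
  rw [h1, e2, add_zero, add_zero] at h2
  exact ⟨h2, h1⟩

theorem last_column_eq (hκ : κ = 1 ∨ κ = 3)
    (htri : ∀ a b z a' b' z', IsZCorner d κ a b z a' b' z' →
      G a' b z + (G a b' z + G a b z') = 0)
    (hd : 2 ≤ d) (hprev : ∀ z : ℤ, z % 2 = 0 → 2 ≤ z → z ≤ 2 * d - 2 → G (2 * d - 3) 0 z = 0)
    (hout : ∀ z, G (2 * d - 1) 0 z = 0) (k : ℕ) (hk : k < d) :
    G (2 * d - 2) 0 (2 * k + 1) = G (2 * d - 2) 0 1 := by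
  induction k with
  | zero => simp
  | succ k ih =>
    rw [← ih (by omega)]
    obtain ⟨a', a'', ha', ha'', hmod, hmod'⟩ : ∃ a' a'' : ℤ, (a' = 2 * d - 3 ∨ a' = 2 * d - 1) ∧
        (a'' = 2 * d - 3 ∨ a'' = 2 * d - 1) ∧ (a' + 1 + (2 * k + 1)) % 4 = 4 - κ ∧
        (a'' + 1 + (2 * k + 3)) % 4 = 4 - κ := by
      by_cases h : (2 * d - 3 + 1 + (2 * k + 1) : ℤ) % 4 = 4 - κ
      · exact ⟨2 * d - 3, 2 * d - 1, by omega, by omega, by omega, by omega⟩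
      · exact ⟨2 * d - 1, 2 * d - 3, by omega, by omega, by omega, by omega⟩
    have h1 := htri (2 * d - 2) 0 (2 * k + 2) a' 1 (2 * k + 1) (by unfold IsZCorner; omega)
    have h2 := htri (2 * d - 2) 0 (2 * k + 2) a'' 1 (2 * k + 3) (by unfold IsZCorner; omega)
    have e1 : G a' 0 (2 * k + 2) = 0 := by
      rcases ha' with rfl | rfl
      · exact hprev _ (by omega) (by omega) (by omega)
      · exact hout _
    have e2 : G a'' 0 (2 * k + 2) = 0 := by
      rcases ha'' with rfl | rfl
      · exact hprev _ (by omega) (by omega) (by omega)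
      · exact hout _
    rw [e1, zero_add] at h1
    rw [e2, zero_add] at h2
    have h3 : (2 * ((k + 1 : ℕ) : ℤ) + 1) = 2 * k + 3 := by push_cast; ring
    rw [h3, ← CharTwo.add_eq_zero.1 h1, CharTwo.add_eq_zero.1 h2]

theorem row_step (hκ : κ = 1 ∨ κ = 3)
    (htri : ∀ a b z a' b' z', IsZCorner d κ a b z a' b' z' →
      G a' b z + (G a b' z + G a b z') = 0)
    (a b z : ℤ) (ha : a % 2 = 0 ∧ 0 ≤ a ∧ a ≤ 2 * d - 2)
    (hb : b % 2 = 0 ∧ 2 ≤ b ∧ b ≤ 2 * d - 2)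
    (hz : z % 2 = 0 ∧ 2 ≤ z ∧ z ≤ 2 * d - 2)
    (hpivot : ∀ z', (z' = z - 1 ∨ z' = z + 1) → a ≤ 2 * d - 4 →
      (a + 1 + (b + 1) + z') % 4 = κ → G a b z' = 0)
    (hout : a = 2 * d - 2 → G (a + 1) b z = 0)
    (hprev : G (a - 1) b z = 0) (hbelow : G a (b - 1) z = 0) :
    (G a b (z - 1) = 0 ∧ G a b (z + 1) = 0) ∧ G (a + 1) b z = 0 ∧
      (b ≤ 2 * d - 4 → G a (b + 1) z = 0) := by
  obtain ⟨z', z'', hz', hmod⟩ : ∃ z' z'', (z' = z - 1 ∧ z'' = z + 1 ∨ z' = z + 1 ∧ z'' = z - 1) ∧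
      (a - 1 + (b - 1) + z') % 4 = 4 - κ := by
    by_cases h : (a - 1 + (b - 1) + (z - 1)) % 4 = 4 - κ
    · exact ⟨z - 1, z + 1, by omega, by omega⟩
    · exact ⟨z + 1, z - 1, by omega, by omega⟩
  have h1 := htri a b z (a - 1) (b - 1) z' (by unfold IsZCorner; omega)
  have h2 := htri a b z (a + 1) (b - 1) z'' (by unfold IsZCorner; omega)
  rw [hprev, hbelow, zero_add, zero_add] at h1
  rw [hbelow, zero_add] at h2
  have h4 : G (a + 1) b z = 0 ∧ G a b z'' = 0 := by
    by_cases h : a = 2 * d - 2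
    · rw [hout h, zero_add] at h2
      exact ⟨hout h, h2⟩
    · have := hpivot z'' (by omega) (by omega) (by omega)
      rw [this, add_zero] at h2
      exact ⟨h2, this⟩
  refine ⟨?_, h4.1, fun hb' => ?_⟩
  · rcases hz' with ⟨rfl, rfl⟩ | ⟨rfl, rfl⟩
    · exact ⟨h1, h4.2⟩
    · exact ⟨h4.2, h1⟩
  · have h3 := htri a b z (a - 1) (b + 1) z'' (by unfold IsZCorner; omega)
    rwa [hprev, h4.2, zero_add, add_zero] at h3

variable (d G) in
/-- `G` vanishes near the row with even second coordinate `b`. -/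
def RowZero (b : ℤ) : Prop :=
  ∀ a z : ℤ, a % 2 = 0 → 0 ≤ a → a ≤ 2 * d - 2 → z % 2 = 0 → 2 ≤ z → z ≤ 2 * d - 2 →
    (G a b (z - 1) = 0 ∧ G a b (z + 1) = 0) ∧ G (a + 1) b z = 0 ∧
      (b ≤ 2 * d - 4 → G a (b + 1) z = 0)

theorem rowZero_zero (hκ : κ = 1 ∨ κ = 3) (hd : 2 ≤ d)
    (htri : ∀ a b z a' b' z', IsZCorner d κ a b z a' b' z' →
      G a' b z + (G a b' z + G a b z') = 0)
    (hlow : ∀ b z, G (-1) b z = 0) (hhigh : ∀ b z, G (2 * d - 1) b z = 0)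
    (hpivot : ∀ a z : ℤ, a % 2 = 0 → 0 ≤ a → a ≤ 2 * d - 4 → z % 2 = 1 → 1 ≤ z →
      z ≤ 2 * d - 1 → G a 0 z = 0) (h₀ : G (2 * d - 2) 0 1 = 0) : RowZero d G 0 := by
  have hprev : ∀ k : ℕ, k < d → ∀ z : ℤ, z % 2 = 0 → 2 ≤ z → z ≤ 2 * d - 2 →
      G (2 * k - 1) 0 z = 0 := by
    intro k
    induction k with
    | zero => exact fun _ z _ _ _ => hlow _ _
    | succ k ih =>
      intro hk z hz hz1 hz2
      have h := (row_zero_step hκ htri hd (2 * k) z (by omega) ⟨hz, hz1, hz2⟩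
        (ih (by omega) z hz hz1 hz2) (hpivot _ _ (by omega) (by omega) (by omega) (by omega)
        (by omega) (by omega)) (hpivot _ _ (by omega) (by omega) (by omega) (by omega)
        (by omega) (by omega))).1
      rwa [show 2 * ((k + 1 : ℕ) : ℤ) - 1 = 2 * k + 1 by push_cast; ring]
  have hcol : ∀ a z : ℤ, a % 2 = 0 → 0 ≤ a → a ≤ 2 * d - 2 → z % 2 = 1 → 1 ≤ z →
      z ≤ 2 * d - 1 → G a 0 z = 0 := by
    intro a z ha ha1 ha2 hz hz1 hz2
    by_cases h : a = 2 * d - 2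
    · have hcol := last_column_eq hκ htri hd (fun z hz hz1 hz2 => by
        have := hprev (d - 1) (by omega) z hz hz1 hz2
        rwa [show 2 * ((d - 1 : ℕ) : ℤ) - 1 = 2 * d - 3 by omega] at this) (hhigh 0)
        (z / 2).toNat (by omega)
      rw [h₀] at hcol
      rwa [show 2 * ((z / 2).toNat : ℤ) + 1 = z by omega, ← h] at hcol
    · exact hpivot a z ha ha1 (by omega) hz hz1 hz2
  intro a z ha ha1 ha2 hz hz1 hz2
  have hm := hcol a (z - 1) ha ha1 ha2 (by omega) (by omega) (by omega)
  have hp := hcol a (z + 1) ha ha1 ha2 (by omega) (by omega) (by omega)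
  have hprev' := hprev (a / 2).toNat (by omega) z hz hz1 hz2
  rw [show 2 * ((a / 2).toNat : ℤ) - 1 = a - 1 by omega] at hprev'
  have h := row_zero_step hκ htri hd a z ⟨ha, ha1, ha2⟩ ⟨hz, hz1, hz2⟩ hprev' hm hp
  exact ⟨⟨hm, hp⟩, h.1, fun _ => by rw [zero_add]; exact h.2⟩

theorem rowZero_add_two (hκ : κ = 1 ∨ κ = 3)
    (htri : ∀ a b z a' b' z', IsZCorner d κ a b z a' b' z' →
      G a' b z + (G a b' z + G a b z') = 0)
    (hlow : ∀ b z, G (-1) b z = 0) (hhigh : ∀ b z, G (2 * d - 1) b z = 0)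
    (hpivot : ∀ a b z : ℤ, a % 2 = 0 → 0 ≤ a → a ≤ 2 * d - 4 → b % 2 = 0 → 2 ≤ b →
      b ≤ 2 * d - 2 → z % 2 = 1 → 1 ≤ z → z ≤ 2 * d - 1 →
      (a + 1 + (b + 1) + z) % 4 = κ → G a b z = 0)
    (b : ℤ) (hb : b % 2 = 0 ∧ 2 ≤ b ∧ b ≤ 2 * d - 2) (hrow : RowZero d G (b - 2)) :
    RowZero d G b := by
  have hbelow : ∀ a z : ℤ, a % 2 = 0 → 0 ≤ a → a ≤ 2 * d - 2 → z % 2 = 0 → 2 ≤ z →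
      z ≤ 2 * d - 2 → G a (b - 1) z = 0 := by
    intro a z ha ha1 ha2 hz hz1 hz2
    have := (hrow a z ha ha1 ha2 hz hz1 hz2).2.2 (by omega)
    rwa [show b - 2 + 1 = b - 1 by ring] at this
  have hstep : ∀ a z : ℤ, a % 2 = 0 → 0 ≤ a → a ≤ 2 * d - 2 → z % 2 = 0 → 2 ≤ z →
      z ≤ 2 * d - 2 → G (a - 1) b z = 0 →
      (G a b (z - 1) = 0 ∧ G a b (z + 1) = 0) ∧ G (a + 1) b z = 0 ∧
        (b ≤ 2 * d - 4 → G a (b + 1) z = 0) := by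
    intro a z ha ha1 ha2 hz hz1 hz2 hprev
    refine row_step hκ htri a b z ⟨ha, ha1, ha2⟩ hb ⟨hz, hz1, hz2⟩ (fun z' hz' ha' hmod => ?_)
      (fun h => ?_) hprev (hbelow a z ha ha1 ha2 hz hz1 hz2)
    · exact hpivot a b z' ha ha1 ha' hb.1 hb.2.1 hb.2.2 (by omega) (by omega) (by omega) hmod
    · rw [h, show (2 * d - 2 + 1 : ℤ) = 2 * d - 1 by ring]
      exact hhigh _ _
  have hprev : ∀ k : ℕ, k < d → ∀ z : ℤ, z % 2 = 0 → 2 ≤ z → z ≤ 2 * d - 2 →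
      G (2 * k - 1) b z = 0 := by
    intro k
    induction k with
    | zero => exact fun _ z _ _ _ => hlow _ _
    | succ k ih =>
      intro hk z hz hz1 hz2
      have h := (hstep (2 * k) z (by omega) (by omega) (by omega) hz hz1 hz2
        (ih (by omega) z hz hz1 hz2)).2.1
      rwa [show 2 * ((k + 1 : ℕ) : ℤ) - 1 = 2 * k + 1 by push_cast; ring]
  intro a z ha ha1 ha2 hz hz1 hz2
  have hprev' := hprev (a / 2).toNat (by omega) z hz hz1 hz2
  rw [show 2 * ((a / 2).toNat : ℤ) - 1 = a - 1 by omega] at hprev'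
  exact hstep a z ha ha1 ha2 hz hz1 hz2 hprev'

theorem eq_zero_of_rowZero (hrow : ∀ k : ℕ, k < d → RowZero d G (2 * k)) (a b z : ℤ)
    (hbox : (0 ≤ a ∧ a ≤ 2 * d - 2) ∧ (0 ≤ b ∧ b ≤ 2 * d - 2) ∧ (1 ≤ z ∧ z ≤ 2 * d - 1))
    (hd : 2 ≤ d)
    (hv : (a % 2 = 1 ∧ b % 2 = 0 ∧ z % 2 = 0) ∨ (a % 2 = 0 ∧ b % 2 = 1 ∧ z % 2 = 0) ∨
        (a % 2 = 0 ∧ b % 2 = 0 ∧ z % 2 = 1)) : G a b z = 0 := by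
  have hr := hrow (b / 2).toNat (by omega)
  rcases hv with ⟨ha, hb, hz⟩ | ⟨ha, hb, hz⟩ | ⟨ha, hb, hz⟩
  · rw [show 2 * ((b / 2).toNat : ℤ) = b by omega] at hr
    have := (hr (a - 1) z (by omega) (by omega) (by omega) (by omega) (by omega)
      (by omega)).2.1
    rwa [sub_add_cancel] at this
  · rw [show 2 * ((b / 2).toNat : ℤ) = b - 1 by omega] at hr
    have := (hr a z (by omega) (by omega) (by omega) (by omega) (by omega)
      (by omega)).2.2 (by omega)
    rwa [sub_add_cancel] at this
  · rw [show 2 * ((b / 2).toNat : ℤ) = b by omega] at hr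
    by_cases h : z = 1
    · have := (hr a 2 (by omega) (by omega) (by omega) (by omega) (by omega) (by omega)).1.1
      rwa [h]
    · have := (hr a (z - 1) (by omega) (by omega) (by omega) (by omega) (by omega)
        (by omega)).1.2
      rwa [sub_add_cancel] at this

theorem rowZero_two_mul (hκ : κ = 1 ∨ κ = 3) (hd : 2 ≤ d)
    (htri : ∀ a b z a' b' z', IsZCorner d κ a b z a' b' z' →
      G a' b z + (G a b' z + G a b z') = 0)
    (hlow : ∀ b z, G (-1) b z = 0) (hhigh : ∀ b z, G (2 * d - 1) b z = 0)
    (hpivot : ∀ t ∈ cuboctahedronCentres d κ,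
      G (t.1 - 1) (if t.2.1 = -1 then 0 else t.2.1 - 1) t.2.2 = 0)
    (h₀ : G (2 * d - 2) 0 1 = 0) (k : ℕ) (hk : k < d) : RowZero d G (2 * k) := by
  induction k with
  | zero =>
    rw [Nat.cast_zero, mul_zero]
    refine rowZero_zero hκ hd htri hlow hhigh (fun a z ha ha1 ha2 hz hz1 hz2 => ?_) h₀
    by_cases h : (a + 1 + 1 + z) % 4 = κ
    · have := hpivot (a + 1, 1, z) (by
        rw [mem_cuboctahedronCentres hd]
        simp only
        omega)
      simpa using this
    · have := hpivot (a + 1, -1, z) (by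
        rw [mem_cuboctahedronCentres hd]
        simp only
        omega)
      simpa using this
  | succ k ih =>
    refine rowZero_add_two hκ htri hlow hhigh
      (fun a b z ha ha1 ha2 hb hb1 hb2 hz hz1 hz2 hmod => ?_) _ (by omega) ?_
    · have := hpivot (a + 1, b + 1, z) (by
        rw [mem_cuboctahedronCentres hd]
        simp only
        omega)
      simp only at this
      rwa [if_neg (by omega), add_sub_cancel_right, add_sub_cancel_right] at this
    · rw [show 2 * ((k + 1 : ℕ) : ℤ) - 2 = 2 * k by push_cast; ring]
      exact ih (by omega)

end Kernel

/-! ## The red and blue codes -/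

theorem indicator_eq_ite {d : ℕ} {s : Set Point} {v : Point} {P : Prop} [Decidable P]
    (h : v ∈ latticeVertices d ∧ v ∈ s ↔ P) : indicator d s v = if P then 1 else 0 := by
  by_cases hP : P <;> simp only [indicator, h, hP, if_true, if_false]

theorem sum_triangle_cuboctahedron {d : ℕ} (hd : 2 ≤ d) {c : Colour} {a b z a' b' z' : ℤ}
    (h : IsZCorner d (residue c) a b z a' b' z') {t : ℤ × ℤ × ℤ}
    (ht : t ∈ cuboctahedronCentres d (residue c)) :
    ∑ v ∈ triangle (pt c a b z) (pt c a' b' z'),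
      indicator d (cuboctahedron (pt c t.1 t.2.1 t.2.2)) v = 0 := by
  classical
  have hκ := residue_eq c
  obtain ⟨hp, hbox, hpq, hmod⟩ := h
  obtain ⟨r1, r2, r3⟩ := t
  rw [mem_cuboctahedronCentres hd] at ht
  simp only at ht ⊢
  obtain ⟨⟨ho1, ho2, ho3, hmod'⟩, hr1, hr2, hr3⟩ := ht
  rw [sum_triangle_pt (by omega) (by omega)]
  by_cases hr : (r1 = a - 1 ∨ r1 = a + 1) ∧ (r2 = b - 1 ∨ r2 = b + 1) ∧
    (r3 = z - 1 ∨ r3 = z + 1)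
  · have e1 : indicator d (cuboctahedron (pt c r1 r2 r3)) (pt c a' b z) =
        if a' = r1 then 1 else 0 := by
      refine indicator_eq_ite ?_
      rw [pt_mem_latticeVertices, pt_mem_cuboctahedron]
      omega
    have e2 : indicator d (cuboctahedron (pt c r1 r2 r3)) (pt c a b' z) =
        if b' = r2 then 1 else 0 := by
      refine indicator_eq_ite ?_
      rw [pt_mem_latticeVertices, pt_mem_cuboctahedron]
      omega
    have e3 : indicator d (cuboctahedron (pt c r1 r2 r3)) (pt c a b z') =
        if z' = r3 then 1 else 0 := by
      refine indicator_eq_ite ?_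
      rw [pt_mem_latticeVertices, pt_mem_cuboctahedron]
      omega
    rw [e1, e2, e3]
    clear e1 e2 e3 hbox hr1 hr2 hr3
    split_ifs <;> first | decide | (exfalso; omega)
  · have e1 : indicator d (cuboctahedron (pt c r1 r2 r3)) (pt c a' b z) = 0 := by
      refine if_neg fun h => hr ?_
      have h := h.2
      rw [pt_mem_cuboctahedron] at h
      clear hr hbox hmod hmod' hr1 hr2 hr3
      omega
    have e2 : indicator d (cuboctahedron (pt c r1 r2 r3)) (pt c a b' z) = 0 := by
      refine if_neg fun h => hr ?_
      have h := h.2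
      rw [pt_mem_cuboctahedron] at h
      clear hr hbox hmod hmod' hr1 hr2 hr3
      omega
    have e3 : indicator d (cuboctahedron (pt c r1 r2 r3)) (pt c a b z') = 0 := by
      refine if_neg fun h => hr ?_
      have h := h.2
      rw [pt_mem_cuboctahedron] at h
      clear hr hbox hmod hmod' hr1 hr2 hr3
      omega
    rw [e1, e2, e3]
    decide

theorem sum_triangle_side {d : ℕ} {c : Colour} (hc : c ≠ .green) {a b z a' b' z' : ℤ}
    (h : IsZCorner d (residue c) a b z a' b' z') (s : Bool) :
    ∑ v ∈ triangle (pt c a b z) (pt c a' b' z'),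
      indicator d {v | coord c v = side d c s} v = 0 := by
  classical
  have hs := side_eq (d := d) hc s
  obtain ⟨hp, hbox, hpq, hmod⟩ := h
  rw [sum_triangle_pt (by omega) (by omega)]
  have e1 : indicator d {v | coord c v = side d c s} (pt c a' b z) = 0 := by
    refine if_neg fun h => ?_
    have := h.2
    rw [Set.mem_ofPred_eq, coord_pt hc] at this
    omega
  have e2 : indicator d {v | coord c v = side d c s} (pt c a b' z) =
      if a = side d c s then 1 else 0 := by
    refine indicator_eq_ite ?_
    rw [pt_mem_latticeVertices, Set.mem_ofPred_eq, coord_pt hc]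
    omega
  have e3 : indicator d {v | coord c v = side d c s} (pt c a b z') =
      if a = side d c s then 1 else 0 := by
    refine indicator_eq_ite ?_
    rw [pt_mem_latticeVertices, Set.mem_ofPred_eq, coord_pt hc]
    omega
  rw [e1, e2, e3, zero_add, CharTwo.add_self_eq_zero]

theorem even_cuboctahedron_inter_canonicalZ {d : ℕ} (hd : 2 ≤ d) {c : Colour} (hc : c ≠ .green)
    {t : ℤ × ℤ × ℤ} (ht : t ∈ cuboctahedronCentres d (residue c)) (s₁ s₂ : Bool) :
    Even (qubitsOn d (cuboctahedron (pt c t.1 t.2.1 t.2.2)) ∩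
      canonicalZ d (other c) .green s₁ s₂).card := by
  obtain ⟨r1, r2, r3⟩ := t
  rw [mem_cuboctahedronCentres hd] at ht
  simp only at ht ⊢
  rw [canonicalZ, boundary_eq, boundary_eq, qubitsOn_inter, qubitsOn_inter]
  have h1 := side_eq (d := d) (other_ne_green hc) s₁
  have h2 := side_green d s₂
  generalize side d (other c) s₁ = σ at *
  generalize side d .green s₂ = τ at *
  have hmem : ∀ a b z, pt c a b z ∈ cuboctahedron (pt c r1 r2 r3) ∩
      ({v | coord (other c) v = σ} ∩ {v | coord .green v = τ}) ↔
      pt c a b z ∈ cuboctahedron (pt c r1 r2 r3) ∧ b = σ ∧ z = τ := by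
    intro a b z
    rw [Set.mem_inter_iff, Set.mem_inter_iff, Set.mem_ofPred_eq, Set.mem_ofPred_eq,
      coord_other_pt hc, coord_green_pt]
  by_cases h : (r2 = σ - 1 ∨ r2 = σ + 1) ∧ r3 = τ
  · have : qubitsOn d (cuboctahedron (pt c r1 r2 r3) ∩
        ({v | coord (other c) v = σ} ∩ {v | coord .green v = τ})) =
        qubitsOn d ↑({pt c (r1 - 1) σ τ, pt c (r1 + 1) σ τ} : Finset Point) := by
      refine qubitsOn_congr fun v _ => ?_
      obtain ⟨a, b, z, rfl⟩ := exists_eq_pt c v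
      rw [hmem, pt_mem_cuboctahedron, Finset.mem_coe, Finset.mem_insert, Finset.mem_singleton,
        pt_inj, pt_inj]
      clear ht
      omega
    rw [this, card_qubitsOn_coe, Finset.card_pair]
    · exact even_two
    · rw [Ne, pt_inj]
      omega
    · intro v
      rw [Finset.mem_insert, Finset.mem_singleton]
      rintro (rfl | rfl) <;> rw [pt_mem_latticeVertices] <;> omega
  · have : qubitsOn d (cuboctahedron (pt c r1 r2 r3) ∩
        ({v | coord (other c) v = σ} ∩ {v | coord .green v = τ})) = ∅ := by
      refine Finset.eq_empty_of_forall_notMem fun v hv => ?_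
      obtain ⟨a, b, z, hv'⟩ := exists_eq_pt c v.1
      rw [mem_qubitsOn, hv', hmem, pt_mem_cuboctahedron] at hv
      omega
    rw [this, Finset.card_empty]
    exact Even.zero

/-- A qubit of the cut cuboctahedron with centre `t` of smallest rank. -/
def cuboctahedronPivot {d : ℕ} (hd : 2 ≤ d) (c : Colour)
    (t : cuboctahedronCentres d (residue c)) : Qubit d :=
  ⟨pt c (t.1.1 - 1) (if t.1.2.1 = -1 then 0 else t.1.2.1 - 1) t.1.2.2, by
    have := (mem_cuboctahedronCentres hd).1 t.2
    rw [pt_mem_latticeVertices]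
    split_ifs <;> omega⟩

theorem ne_other {c : Colour} (hc : c ≠ .green) : c ≠ other c := by
  cases c <;> simp_all [other]

theorem isPivotedCode_of_ne_green {d : ℕ} (hd : 2 ≤ d) {c : Colour} (hc : c ≠ .green) :
    IsPivotedCode (xSupports d c) (zSupports d c)
      (fun t : cuboctahedronCentres d (residue c) =>
        qubitsOn d (cuboctahedron (pt c t.1.1 t.1.2.1 t.1.2.2)))
      (cuboctahedronPivot hd c) (fun v => v.1.1 + v.1.2.1)
      (canonicalX d c false) (canonicalZ d (other c) .green false false)
      ⟨pt c (2 * d - 2) 0 1, by rw [pt_mem_latticeVertices]; omega⟩ where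
  range_eq := by
    rw [xSupports_eq hd hc]
    ext s
    constructor
    · rintro ⟨t, rfl⟩
      exact ⟨t.1, t.2, rfl⟩
    · rintro ⟨t, ht, rfl⟩
      exact ⟨⟨t, ht⟩, rfl⟩
  pivot_mem t := by
    rw [mem_qubitsOn]
    simp only [cuboctahedronPivot]
    rw [pt_mem_cuboctahedron]
    split_ifs <;> omega
  rank_lt t u htu h := by
    have ht := (mem_cuboctahedronCentres hd).1 t.2
    have hu := (mem_cuboctahedronCentres hd).1 u.2
    rw [mem_qubitsOn] at h
    simp only [cuboctahedronPivot, pt_sum] at h ⊢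
    rw [pt_mem_cuboctahedron] at h
    rw [Ne, Subtype.ext_iff, Prod.ext_iff, Prod.ext_iff] at htu
    have hκ := residue_eq c
    split_ifs at h ⊢ <;> omega
  even_inter := by
    rw [zSupports_eq hc, xSupports_eq hd hc]
    rintro _ ⟨t, ht, rfl⟩ _ ⟨a, b, z, a', b', z', h, rfl⟩
    exact even_card_qubitsOn_inter.2 (sum_triangle_cuboctahedron hd h ht)
  even_x₀ := by
    rw [zSupports_eq hc]
    rintro _ ⟨a, b, z, a', b', z', h, rfl⟩
    exact even_card_qubitsOn_inter.2 (sum_triangle_side hc h _)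
  even_z₀ := by
    rw [xSupports_eq hd hc]
    rintro _ ⟨t, ht, rfl⟩
    exact even_cuboctahedron_inter_canonicalZ hd hc ht _ _
  odd_x₀_z₀ := by
    rw [card_canonicalX_inter_canonicalZ d hd _ _ _ (ne_other hc) hc (other_ne_green hc)]
    exact odd_one
  eq_zero f hf hpivot h₀ := by
    funext v
    obtain ⟨a, b, z, hv⟩ := exists_eq_pt c v.1
    have hmem := v.2
    rw [hv, pt_mem_latticeVertices] at hmem
    rw [← extend_coe f v, hv]
    refine eq_zero_of_rowZero (G := fun a b z => extend f (pt c a b z))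
      (rowZero_two_mul (residue_eq c) hd (fun a b z a' b' z' h => ?_) (fun b z => ?_)
        (fun b z => ?_) (fun t ht => ?_) ?_) a b z hmem.1 hd hmem.2
    · obtain ⟨hp, hbox, hpq, hmod⟩ := id h
      rw [← sum_triangle_pt (by omega) (by omega), ← sum_qubitsOn]
      refine hf _ ?_
      rw [zSupports_eq hc]
      exact ⟨a, b, z, a', b', z', h, rfl⟩
    · refine extend_of_notMem f ?_
      rw [pt_mem_latticeVertices]
      omega
    · refine extend_of_notMem f ?_
      rw [pt_mem_latticeVertices]
      omega
    · exact (extend_coe f (cuboctahedronPivot hd c ⟨t, ht⟩)).trans (hpivot ⟨t, ht⟩)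
    · exact (extend_coe f ⟨_, _⟩).trans h₀

theorem isLogicalPair_of_ne_green {d : ℕ} (hd : 2 ≤ d) {c : Colour} (hc : c ≠ .green)
    (c₁ c₂ : Colour) (h₁ : c ≠ c₁) (h₂ : c ≠ c₂) (h₁₂ : c₁ ≠ c₂) (s s₁ s₂ : Bool) :
    IsLogicalPair (stabilizerGroup d c) (xOp (canonicalX d c s))
      (zOp (canonicalZ d c₁ c₂ s₁ s₂)) := by
  refine isLogicalPair_closure ?_ ?_ ?_
  · rw [zSupports_eq hc]
    rintro _ ⟨a, b, z, a', b', z', h, rfl⟩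
    exact even_card_qubitsOn_inter.2 (sum_triangle_side hc h _)
  · rw [xSupports_eq hd hc]
    rintro _ ⟨t, ht, rfl⟩
    have hcases : c₁ = other c ∧ c₂ = .green ∨ c₁ = .green ∧ c₂ = other c := by
      cases c <;> cases c₁ <;> cases c₂ <;> simp_all [other]
    rcases hcases with ⟨rfl, rfl⟩ | ⟨rfl, rfl⟩
    · exact even_cuboctahedron_inter_canonicalZ hd hc ht _ _
    · rw [canonicalZ_comm]
      exact even_cuboctahedron_inter_canonicalZ hd hc ht _ _
  · rw [card_canonicalX_inter_canonicalZ d hd _ _ _ h₁ h₂ h₁₂]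
    exact odd_one

end Stack3D

open Stack3D
theorem mainTheorem3 (d : ℕ) (hd : 2 ≤ d) :
    -- the number of physical qubits of each code
    ((Fintype.card (Qubit d) : ℚ) = 3 * (d : ℚ) ^ 3 - 4 * (d : ℚ) ^ 2 + 2 * (d : ℚ)) ∧
    -- the stabilizer generators of the green code
    (HasIndependentGenerators (xStabilizers d .green) ((d : ℚ) ^ 2 * ((d : ℚ) - 1)) ∧
      IsIndependent (xStabilizers d .green) ∧
      HasIndependentGenerators (zStabilizers d .green)
        (((d : ℚ) - 1) * (2 * (d : ℚ) ^ 2 - (d : ℚ) + 1))) ∧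
    -- the stabilizer generators of the red code and of the blue code
    (∀ c : Colour, c ≠ .green →
      HasIndependentGenerators (xStabilizers d c)
        (((d : ℚ) - 1) / 2 * ((d : ℚ) ^ 2 + (d : ℚ))) ∧
      IsIndependent (xStabilizers d c) ∧
      HasIndependentGenerators (zStabilizers d c)
        (((d : ℚ) - 1) / 2 * (5 * (d : ℚ) ^ 2 - 3 * (d : ℚ) + 2))) ∧
    -- each code is a stabilizer code with `n - 1` independent generators and one logical qubit
    (∀ c : Colour,
      IsStabilizerGroup (stabilizerGroup d c) ∧
      HasIndependentGenerators (xStabilizers d c ∪ zStabilizers d c)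
        (3 * (d : ℚ) ^ 3 - 4 * (d : ℚ) ^ 2 + 2 * (d : ℚ) - 1) ∧
      HasIndependentGenerators (xStabilizers d c ∪ zStabilizers d c)
        ((Fintype.card (Qubit d) : ℚ) - 1) ∧
      EncodesLogicalQubits (stabilizerGroup d c) 1) ∧
    -- the weights of the canonical logical operators
    (∀ c₁ c₂ : Colour, c₁ ≠ c₂ → ∀ s₁ s₂ : Bool, (canonicalZ d c₁ c₂ s₁ s₂).card = d) ∧
    (∀ s : Bool, (canonicalX d .green s).card = d ^ 2) ∧
    (∀ c : Colour, c ≠ .green → ∀ s : Bool, (canonicalX d c s).card = d ^ 2 + (d - 1) ^ 2) ∧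
    -- they are logical operators of the encoded qubit
    (∀ c c₁ c₂ : Colour, c ≠ c₁ → c ≠ c₂ → c₁ ≠ c₂ → ∀ s s₁ s₂ : Bool,
      IsLogicalPair (stabilizerGroup d c) (xOp (canonicalX d c s))
        (zOp (canonicalZ d c₁ c₂ s₁ s₂))) := by
  have hgreen := isPivotedCode_green d hd
  have hcol : ∀ c : Colour, c ≠ .green → _ := fun c hc => isPivotedCode_of_ne_green hd hc
  have hn := card_qubit d hd
  have hcard : ∀ c, (Fintype.card (cuboctahedronCentres d (residue c)) : ℚ) =
      ((d : ℚ) - 1) / 2 * ((d : ℚ) ^ 2 + (d : ℚ)) := fun c =>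
    card_cuboctahedronCentres d hd (residue_eq c)
  have hcommon : ∀ c : Colour, IsStabilizerGroup (stabilizerGroup d c) ∧
      HasIndependentGenerators (xStabilizers d c ∪ zStabilizers d c)
        ((Fintype.card (Qubit d) : ℚ) - 1) ∧
      EncodesLogicalQubits (stabilizerGroup d c) 1 := by
    intro c
    by_cases hc : c = .green
    · subst hc
      exact ⟨hgreen.isStabilizerGroup, hgreen.hasIndependentGenerators,
        hgreen.finrank_codeSpace_eq⟩
    · exact ⟨(hcol c hc).isStabilizerGroup, (hcol c hc).hasIndependentGenerators,
        (hcol c hc).finrank_codeSpace_eq⟩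
  refine ⟨hn, ⟨?_, hgreen.isIndependent_x, ?_⟩, fun c hc => ⟨?_, (hcol c hc).isIndependent_x, ?_⟩,
    fun c => ⟨(hcommon c).1, ?_, (hcommon c).2.1, (hcommon c).2.2⟩,
    fun c₁ c₂ h s₁ s₂ => card_canonicalZ d c₁ c₂ h s₁ s₂, card_canonicalX_green d,
    fun c hc s => ?_, fun c c₁ c₂ h₁ h₂ h₁₂ s s₁ s₂ => ?_⟩
  · rw [← card_greenCentres d hd]
    exact hgreen.hasIndependentGenerators_x
  · have h := hgreen.hasIndependentGenerators_z
    rw [hn, card_greenCentres d hd] at h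
    convert h using 1
    · rfl
    · ring
  · rw [← hcard c]
    exact (hcol c hc).hasIndependentGenerators_x
  · have h := (hcol c hc).hasIndependentGenerators_z
    rw [hn, hcard] at h
    convert h using 1
    · rfl
    · ring
  · rw [← hn]
    exact (hcommon c).2.1
  · cases c
    · exact card_canonicalX_red d hd s
    · exact absurd rfl hc
    · exact card_canonicalX_blue d hd s
  · by_cases hc : c = .green
    · subst hc
      exact isLogicalPair_green d hd c₁ c₂ h₁ h₂ h₁₂ s s₁ s₂
    · exact isLogicalPair_of_ne_green hd hc c₁ c₂ h₁ h₂ h₁₂ s s₁ s₂
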